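/- Let $U(t)$, $t\in\mathbb R$, denote the Airy group: for $f\in C_0^\infty(\mathbb R)$ (complex-valued), $U(t)f=\big(e^{it\xi^3}\hat f\,\big)^{\vee}$, where $\hat f(\xi)=\int_{\mathbb R}e^{-ix\xi}f(x)\,dx$ and ${}^\vee$ is the inverse Fourier transform; that is, $u(x,t)=U(t)f(x)$ solves $\partial_tu+\partial_x^3u=0$, $u(x,0)=f(x)$. For $\sigma\in\mathbb R$ let $\|f\|_{H^\sigma}=\|\langle D_x\rangle^{\sigma}f\|_{2}$, where $\langle D_x\rangle^\sigma$ is the Fourier multiplier with symbol $(1+\xi^2)^{\sigma/2}$. **Lemma 4.6.** Let $s\ge 0$ be real. There is a constant $C$ depending only on $s$ such that for all $u_0\in C_0^\infty(\mathbb R)$ and all $t\in\mathbb R$, $$\big\||x|^{s}U(t)u_0\big\|_{2}\le C\Big((1+|t|+|t|^{s})\,\|u_0\|_{H^{2s}}+\big\||x|^{s}u_0\big\|_{2}\Big).$$ In particular the left-hand side is finite. -/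

import Mathlib

open MeasureTheory FourierTransform
open scoped ENNReal NNReal ContDiff

/-- The Airy group `U(t)`: the Fourier multiplier with symbol `exp (i t k ^ 3)` at angular
frequency `k`, that is, the solution operator of `∂ₜ u + ∂ₓ³ u = 0`, `u(0) = f`.  Mathlib's Fourier
transform is normalised by `𝓕 f ξ = ∫ exp (-2 π i x ξ) f x dx`, so that `k = 2 π ξ`. -/
noncomputable def airyGroup (t : ℝ) (f : ℝ → ℂ) : ℝ → ℂ :=
  𝓕⁻ fun ξ : ℝ => Complex.exp (Complex.I * t * (2 * Real.pi * ξ) ^ 3) * 𝓕 f ξ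

/-- The norm `‖f‖_{H^σ} = ‖⟨D⟩ ^ σ f‖₂` with `⟨D⟩ = (1 - ∂ₓ²) ^ (1/2)`, whose symbol is
`(1 + k ^ 2) ^ (1/2)` at angular frequency `k = 2 π ξ`; by Plancherel it is computed on the
Fourier side. -/
noncomputable def sobolevNorm (σ : ℝ) (f : ℝ → ℂ) : ℝ≥0∞ :=
  eLpNorm (fun ξ : ℝ => (1 + (2 * Real.pi * ξ) ^ 2) ^ (σ / 2) • 𝓕 f ξ) 2 volume

/-- The weighted norm `‖|x| ^ s f‖₂`. -/
noncomputable def weightedNorm (s : ℝ) (f : ℝ → ℂ) : ℝ≥0∞ :=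
  eLpNorm (fun x : ℝ => |x| ^ s • f x) 2 volume

/-- `U(0)` is the identity on test functions. -/
theorem airyGroup_zero {f : ℝ → ℂ} (hf : ContDiff ℝ ∞ f) (hc : HasCompactSupport f) :
    airyGroup 0 f = f := by
  let g : SchwartzMap ℝ ℂ := hc.toSchwartzMap hf
  have hg : 𝓕 f = (𝓕 g : SchwartzMap ℝ ℂ) := SchwartzMap.fourier_coe g
  have h1 : airyGroup 0 f = 𝓕⁻ (𝓕 f) := by
    simp [airyGroup]
  rw [h1]
  exact hf.continuous.fourierInv_fourier_eq g.integrable (hg ▸ (𝓕 g).integrable)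

/-- `u(x, t) = (U(t) f)(x)` solves the linear equation `∂ₜ u + ∂ₓ³ u = 0`. -/
theorem hasDerivAt_airyGroup {f : ℝ → ℂ} (hf : ContDiff ℝ ∞ f) (hc : HasCompactSupport f)
    (t x : ℝ) :
    HasDerivAt (fun τ => airyGroup τ f x) (-iteratedDeriv 3 (airyGroup t f) x) t := by
  let g : SchwartzMap ℝ ℂ := hc.toSchwartzMap hf
  have hg : 𝓕 f = (𝓕 g : SchwartzMap ℝ ℂ) := SchwartzMap.fourier_coe g
  have hnorm (τ ξ : ℝ) : ‖Complex.exp (Complex.I * τ * (2 * Real.pi * ξ) ^ 3)‖ = 1 := by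
    have : Complex.I * τ * (2 * Real.pi * ξ) ^ 3
        = ((τ * (2 * Real.pi * ξ) ^ 3 : ℝ) : ℂ) * Complex.I := by push_cast; ring
    rw [this, Complex.norm_exp_ofReal_mul_I]
  have hint (τ : ℝ) (n : ℕ) : Integrable (fun ξ : ℝ =>
      ξ ^ n • (Complex.exp (Complex.I * τ * (2 * Real.pi * ξ) ^ 3) * 𝓕 f ξ)) := by
    refine ((𝓕 g).integrable_pow_mul volume n).mono' ?_ (.of_forall fun ξ => ?_)
    · rw [hg]
      exact (by fun_prop : Continuous _).aestronglyMeasurable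
    · rw [norm_smul, norm_mul, hnorm, hg]
      simp
  have hx : iteratedDeriv 3 (airyGroup t f) x = ∫ ξ : ℝ,
      Complex.exp (2 * Real.pi * Complex.I * x * ξ) * ((2 * Real.pi * Complex.I * ξ) ^ 3 *
        (Complex.exp (Complex.I * t * (2 * Real.pi * ξ) ^ 3) * 𝓕 f ξ)) := by
    have h1 : airyGroup t f = fun y => 𝓕 (fun ξ : ℝ =>
        Complex.exp (Complex.I * t * (2 * Real.pi * ξ) ^ 3) * 𝓕 f ξ) (-y) := by
      ext y
      exact Real.fourierInv_eq_fourier_neg _ _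
    rw [h1, iteratedDeriv_comp_neg, Real.iteratedDeriv_fourier (N := ⊤)
      (fun n _ => hint t n) le_top, Real.fourier_real_eq_integral_exp_smul, ← integral_smul]
    refine integral_congr_ae (.of_forall fun ξ => ?_)
    have h2 : Complex.exp (((-2 * Real.pi * ξ * -x : ℝ) : ℂ) * Complex.I)
        = Complex.exp (2 * Real.pi * Complex.I * x * ξ) := by
      congr 1; push_cast; ring
    simp only [h2, smul_eq_mul, Complex.real_smul]
    push_cast
    ring
  have ht (τ : ℝ) : airyGroup τ f x = ∫ ξ : ℝ, Complex.exp (2 * Real.pi * Complex.I * x * ξ) *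
      (Complex.exp (Complex.I * τ * (2 * Real.pi * ξ) ^ 3) * 𝓕 f ξ) := by
    simp only [airyGroup]
    rw [Real.fourierInv_eq']
    refine integral_congr_ae (.of_forall fun ξ => ?_)
    simp only [smul_eq_mul]
    congr 2
    simp
    ring
  have hnx (ξ : ℝ) : ‖Complex.exp (2 * Real.pi * Complex.I * x * ξ)‖ = 1 := by
    have : 2 * Real.pi * Complex.I * x * ξ
        = ((2 * Real.pi * x * ξ : ℝ) : ℂ) * Complex.I := by push_cast; ring
    rw [this, Complex.norm_exp_ofReal_mul_I]
  simp only [ht]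
  rw [hx, ← integral_neg]
  refine (hasDerivAt_integral_of_dominated_loc_of_deriv_le (μ := volume)
    (bound := fun ξ : ℝ => (2 * Real.pi) ^ 3 * (‖ξ‖ ^ 3 * ‖(𝓕 g) ξ‖)) (s := Set.univ)
    (F' := fun (τ : ℝ) (ξ : ℝ) => -(Complex.exp (2 * Real.pi * Complex.I * x * ξ) *
      ((2 * Real.pi * Complex.I * ξ) ^ 3 *
        (Complex.exp (Complex.I * τ * (2 * Real.pi * ξ) ^ 3) * 𝓕 f ξ))))
    Filter.univ_mem ?_ ?_ ?_ ?_ ?_ ?_).2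
  · rw [hg]
    exact .of_forall fun τ => (by fun_prop : Continuous _).aestronglyMeasurable
  · refine ((hint t 0).norm).mono' ?_ (.of_forall fun ξ => ?_)
    · rw [hg]
      exact (by fun_prop : Continuous _).aestronglyMeasurable
    · rw [norm_mul, hnx]
      simp
  · rw [hg]
    exact (by fun_prop : Continuous _).aestronglyMeasurable
  · refine .of_forall fun ξ τ _ => ?_
    rw [norm_neg, norm_mul, hnx, norm_mul, norm_mul, hnorm, hg]
    simp [mul_pow, abs_of_pos Real.pi_pos, mul_assoc]
  · exact ((𝓕 g).integrable_pow_mul volume 3).const_mul _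
  · refine .of_forall fun ξ τ _ => ?_
    have h3 : HasDerivAt (fun τ : ℝ => Complex.I * (τ : ℂ) * (2 * Real.pi * ξ) ^ 3)
        (Complex.I * (2 * Real.pi * ξ) ^ 3) τ := by
      have := ((Complex.ofRealCLM.hasDerivAt (x := τ)).const_mul Complex.I).mul_const
        ((2 * Real.pi * ξ : ℂ) ^ 3)
      simpa using this
    refine ((h3.cexp.mul_const (𝓕 f ξ)).const_mul
      (Complex.exp (2 * Real.pi * Complex.I * x * ξ))).congr_deriv ?_
    have h4 : Complex.I ^ 3 = -Complex.I := by rw [pow_succ, Complex.I_sq]; ring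
    simp only [mul_pow, h4]
    ring

/-! ### Pointwise estimates for iterated forward differences -/

/-! On the Fourier side the weight |x|^s measures L² smoothness of order s. For 0 < s < n, |x|^(2s)
is comparable, up to an additive 1, to the sum over m of 4^(sm) |exp(-2πi x/2^m) - 1|^(2n). By
Plancherel the weighted norm is thus, up to the L² norm, a sum over scales h = 2^(-m) of 4^(sm)
‖Δ_h^n û‖². This treats all real s > 0 at once, and the claim becomes a bound for multiplication by
the symbol A = exp(itk³).

The phase has derivative of size at most a multiple of M = (1+|t|)(1+k²), and A is bounded on
complex discs of radius 1/M. Cauchy's estimates then give |Δ_h^i A| ≲ w^i with w = min(1, hM)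
(`EntireMultiplier.enorm_fwdDiff_iter_le`), and the Leibniz rule bounds Δ_h^n(Ag) by shifts of
w^(n-k) Δ_h^k g, 0 ≤ k ≤ n. The term k = n is the weighted norm of the data. The term k = 0, summed
over scales, is at most a multiple of ∫ M^(2s)|g|², that is, of (1+|t|)^(2s) ‖u₀‖² in H^(2s).

The intermediate terms are controlled by these two (`exists_scaleEnergy_le`). Marchaud's inequality
replaces Δ_h^k by 2^(-k) Δ_{2h}^k plus differences of order k+1. With the weights, and after
squaring, passing from h to 2h costs the factor 2·4^(-n), which beats the scale factor 4^s once n ≥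
s+1, so the sum over scales absorbs it. -/

theorem fwdDiff_iter_sub (h : ℝ) (n : ℕ) (f g : ℝ → ℂ) :
    (fwdDiff h)^[n] (f - g) = (fwdDiff h)^[n] f - (fwdDiff h)^[n] g := by
  have := map_sub (fwdDiff_aux.fwdDiffₗ ℝ ℂ h ^ n) f g
  simpa only [fwdDiff_aux.coe_fwdDiffₗ_pow] using this

theorem Continuous.fwdDiff_iter {g : ℝ → ℂ} (hg : Continuous g) (h : ℝ) (n : ℕ) :
    Continuous ((fwdDiff h)^[n] g) := by
  induction n generalizing g with
  | zero => exact hg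
  | succ n ih =>
    rw [Function.iterate_succ_apply]
    exact ih (by unfold fwdDiff; fun_prop)

/-- A Leibniz rule for iterated differences, as an upper bound. -/
theorem enorm_fwdDiff_iter_mul_le (h : ℝ) (n : ℕ) (a g : ℝ → ℂ) (ξ : ℝ) (B : ℝ≥0∞)
    (hB : ∀ i j, i + j = n →
      ‖(fwdDiff h)^[i] a ξ‖ₑ * ‖(fwdDiff h)^[j] g (ξ + i * h)‖ₑ ≤ B) :
    ‖(fwdDiff h)^[n] (fun x => a x * g x) ξ‖ₑ ≤ 2 ^ n * B := by
  induction n generalizing a g with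
  | zero => simpa using hB 0 0 rfl
  | succ n ih =>
    -- Δ(ag) = Δa · g(·+h) + a · Δg, written as a difference so that linearity is only needed for
    -- subtraction.
    have h1 : fwdDiff h (fun x => a x * g x) =
        fun x => fwdDiff h a x * g (x + h) - (-a x) * fwdDiff h g x := by
      ext x
      simp only [fwdDiff]
      ring
    have h2 := ih (fwdDiff h a) (fun x => g (x + h)) fun i j hij => by
      have := hB (i + 1) j (by omega)
      rw [fwdDiff_iter_comp_add]
      rw [Function.iterate_succ_apply] at this
      convert this using 4
      push_cast
      ring
    have h3 := ih (fun x => -a x) (fwdDiff h g) fun i j hij => by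
      have := hB i (j + 1) (by omega)
      rw [Function.iterate_succ_apply (n := j)] at this
      have h4 : (fwdDiff h)^[i] (fun x => -a x) = -(fwdDiff h)^[i] a := by
        have := fwdDiff_iter_const_smul h (-1 : ℂ) a i
        simp only [neg_smul, one_smul] at this
        exact this
      rwa [h4, Pi.neg_apply, enorm_neg]
    rw [Function.iterate_succ_apply, h1]
    have h5 := fwdDiff_iter_sub h n (fun x => fwdDiff h a x * g (x + h))
      (fun x => (-a x) * fwdDiff h g x)
    calc _ = ‖(fwdDiff h)^[n] (fun x => fwdDiff h a x * g (x + h)) ξ -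
          (fwdDiff h)^[n] (fun x => (-a x) * fwdDiff h g x) ξ‖ₑ := congrArg _ (congrFun h5 ξ)
      _ ≤ 2 ^ n * B + 2 ^ n * B := enorm_sub_le.trans (add_le_add h2 h3)
      _ = _ := by ring

theorem sum_range_succ_add_le (k : ℕ) (F : ℕ → ℝ≥0∞) :
    ∑ i ∈ Finset.range k, (F (i + 1) + F i) ≤ 2 * ∑ i ∈ Finset.range (k + 1), F i := by
  rw [Finset.sum_add_distrib, two_mul]
  gcongr
  · rw [Finset.sum_range_succ' F k]
    exact le_self_add
  · simp

theorem enorm_fwdDiff_iter_le (h : ℝ) (k : ℕ) (g : ℝ → ℂ) (ξ : ℝ) :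
    ‖(fwdDiff h)^[k] g ξ‖ₑ ≤ 2 ^ k * ∑ i ∈ Finset.range (k + 1), ‖g (ξ + i * h)‖ₑ := by
  induction k generalizing g with
  | zero => simp
  | succ k ih =>
    rw [Function.iterate_succ_apply]
    refine (ih _).trans ?_
    rw [pow_succ, mul_assoc]
    gcongr
    refine le_trans (Finset.sum_le_sum fun i _ => ?_)
      (sum_range_succ_add_le (k + 1) fun i => ‖g (ξ + i * h)‖ₑ)
    simp only [fwdDiff]
    refine enorm_sub_le.trans_eq ?_
    push_cast
    ring_nf

/-- With τ the translation by h, τ² - 1 = (τ + 1)(τ - 1): each factor Δ_{2h} is a sum of two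
translates of Δ_h. -/
theorem enorm_fwdDiff_two_mul_iter_le (h : ℝ) (k : ℕ) (g : ℝ → ℂ) (ξ : ℝ) :
    ‖(fwdDiff (2 * h))^[k] g ξ‖ₑ ≤
      2 ^ k * ∑ i ∈ Finset.range (k + 1), ‖(fwdDiff h)^[k] g (ξ + i * h)‖ₑ := by
  induction k generalizing g with
  | zero => simp
  | succ k ih =>
    have h1 : fwdDiff (2 * h) g = (fun x => fwdDiff h g (x + h)) - -fwdDiff h g := by
      ext x
      simp only [fwdDiff, Pi.sub_apply, Pi.neg_apply]
      ring_nf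
    rw [Function.iterate_succ_apply]
    refine (ih _).trans ?_
    rw [pow_succ, mul_assoc]
    gcongr
    refine le_trans (Finset.sum_le_sum fun i _ => ?_)
      (sum_range_succ_add_le (k + 1) fun i => ‖(fwdDiff h)^[k + 1] g (ξ + i * h)‖ₑ)
    have h4 : (fwdDiff h)^[k] (-fwdDiff h g) = -(fwdDiff h)^[k] (fwdDiff h g) := by
      simpa using fwdDiff_iter_const_smul h (-1 : ℂ) (fwdDiff h g) k
    rw [h1, fwdDiff_iter_sub, h4, Pi.sub_apply, fwdDiff_iter_comp_add, Pi.neg_apply,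
      Function.iterate_succ_apply]
    refine enorm_sub_le.trans_eq ?_
    rw [enorm_neg]
    push_cast
    ring_nf

/-- Marchaud's inequality, pointwise. -/
theorem enorm_fwdDiff_iter_le_two_mul (h : ℝ) (k : ℕ) (g : ℝ → ℂ) (ξ : ℝ) :
    ‖(fwdDiff h)^[k] g ξ‖ₑ ≤ (2 ^ k)⁻¹ * ‖(fwdDiff (2 * h))^[k] g ξ‖ₑ +
      k * ∑ i ∈ Finset.range k, ‖(fwdDiff h)^[k + 1] g (ξ + i * h)‖ₑ := by
  induction k generalizing g with
  | zero => simp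
  | succ k ih =>
    -- τ² - 1 = 2(τ - 1) + (τ - 1)², solved for τ - 1.
    have h1 : fwdDiff h g = (2⁻¹ : ℂ) • (fwdDiff (2 * h) g - (fwdDiff h)^[2] g) := by
      ext x
      simp only [Function.iterate_succ_apply, Function.iterate_zero, id, fwdDiff, Pi.sub_apply,
        Pi.smul_apply, smul_eq_mul]
      ring_nf
    have h2 : ‖(2⁻¹ : ℂ)‖ₑ = 2⁻¹ := by
      rw [enorm_inv (by norm_num)]
      congr 1
      simp [enorm_eq_nnnorm]
    have h3 : ‖(fwdDiff (2 * h))^[k] (fwdDiff h g) ξ‖ₑ ≤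
        2⁻¹ * ‖(fwdDiff (2 * h))^[k + 1] g ξ‖ₑ +
          2 ^ k * ∑ i ∈ Finset.range (k + 1), ‖(fwdDiff h)^[k + 2] g (ξ + i * h)‖ₑ := by
      rw [h1, fwdDiff_iter_const_smul, fwdDiff_iter_sub, Pi.smul_apply, enorm_smul, h2,
        Pi.sub_apply]
      refine (mul_le_mul_right enorm_sub_le _).trans ?_
      rw [mul_add, Function.iterate_succ_apply (n := k)]
      refine add_le_add le_rfl ?_
      have h6 : (2⁻¹ : ℝ≥0∞) ≤ 1 := ENNReal.inv_le_one.2 one_le_two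
      refine (mul_le_of_le_one_left zero_le h6).trans ?_
      refine (enorm_fwdDiff_two_mul_iter_le h k _ ξ).trans_eq ?_
      rfl
    rw [Function.iterate_succ_apply]
    refine (ih _).trans ?_
    -- The 2^k lost in `h3` cancels the 2^(-k) of the induction hypothesis, so each step adds a
    -- single window of differences; this gives the linear factor k.
    have h5 : ((2 : ℝ≥0∞) ^ k)⁻¹ * 2 ^ k = 1 := ENNReal.inv_mul_cancel (by simp) (by simp)
    calc _ ≤ (2 ^ k)⁻¹ * (2⁻¹ * ‖(fwdDiff (2 * h))^[k + 1] g ξ‖ₑ +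
          2 ^ k * ∑ i ∈ Finset.range (k + 1), ‖(fwdDiff h)^[k + 2] g (ξ + i * h)‖ₑ) +
          k * ∑ i ∈ Finset.range (k + 1), ‖(fwdDiff h)^[k + 2] g (ξ + i * h)‖ₑ := by
          refine add_le_add (mul_le_mul_right h3 _) (mul_le_mul_right ?_ _)
          exact Finset.sum_le_sum_of_subset (Finset.range_mono k.le_succ)
      _ = _ := by
        rw [mul_add, ← mul_assoc, ← mul_assoc, h5, pow_succ,
          ENNReal.mul_inv (by simp) (by simp)]
        push_cast
        ring

/-! ### Weighted energies of iterated differences -/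

theorem ENNReal.add_sq_le_two_mul (a b : ℝ≥0∞) : (a + b) ^ 2 ≤ 2 * (a ^ 2 + b ^ 2) := by
  have := ENNReal.rpow_add_le_mul_rpow_add_rpow a b (p := 2) (by norm_num)
  norm_num at this
  exact this

theorem ENNReal.sq_sum_range_le (n : ℕ) (F : ℕ → ℝ≥0∞) :
    (∑ i ∈ Finset.range n, F i) ^ 2 ≤ 2 ^ n * ∑ i ∈ Finset.range n, F i ^ 2 := by
  induction n with
  | zero => simp
  | succ n ih =>
    rw [Finset.sum_range_succ, Finset.sum_range_succ]
    refine (ENNReal.add_sq_le_two_mul _ _).trans ?_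
    rw [pow_succ' (2 : ℝ≥0∞), mul_assoc, mul_add (2 ^ n)]
    gcongr
    exact le_mul_of_one_le_left zero_le (one_le_pow₀ one_le_two)

/-- The truncated weight `min 1 (h M(ξ))`. -/
noncomputable def stepWeight (M : ℝ → ℝ) (h ξ : ℝ) : ℝ≥0∞ := min 1 (ENNReal.ofReal (h * M ξ))

theorem stepWeight_le_one (M : ℝ → ℝ) (h ξ : ℝ) : stepWeight M h ξ ≤ 1 := min_le_left _ _

theorem measurable_stepWeight {M : ℝ → ℝ} (hM : Continuous M) (h : ℝ) :
    Measurable (stepWeight M h) := by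
  unfold stepWeight
  fun_prop

/-- The energy of the `k`-th difference of `g` with step `h`, the missing `n - k` differences being
replaced by powers of the weight. -/
noncomputable def diffEnergy (M : ℝ → ℝ) (n k : ℕ) (h : ℝ) (g : ℝ → ℂ) : ℝ≥0∞ :=
  ∫⁻ ξ, stepWeight M h ξ ^ (2 * (n - k)) * ‖(fwdDiff h)^[k] g ξ‖ₑ ^ 2

/-- `M` varies by at most the factor `K` over distances up to `N`. -/
def SlowlyVarying (M : ℝ → ℝ) (K : ℝ≥0) (N : ℕ) : Prop :=
  1 ≤ K ∧ ∀ ξ d : ℝ, |d| ≤ N → M ξ ≤ K * M (ξ + d)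

theorem SlowlyVarying.stepWeight_le {M : ℝ → ℝ} {K : ℝ≥0} {N : ℕ} (hK : SlowlyVarying M K N)
    {h : ℝ} (h0 : 0 ≤ h) (h1 : h ≤ 1) {i : ℕ} (hi : i ≤ N) (ξ : ℝ) :
    stepWeight M h ξ ≤ K * stepWeight M h (ξ + i * h) := by
  have hd : (i : ℝ) * h ≤ N := by
    have : (i : ℝ) ≤ N := by exact_mod_cast hi
    nlinarith [Nat.cast_nonneg (α := ℝ) i]
  have h2 := hK.2 ξ (i * h) (by rwa [abs_of_nonneg (by positivity)])
  unfold stepWeight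
  rw [mul_min, mul_one]
  refine le_min ((min_le_left _ _).trans (by exact_mod_cast hK.1)) ((min_le_right _ _).trans ?_)
  rw [← ENNReal.ofReal_coe_nnreal, ← ENNReal.ofReal_mul K.coe_nonneg]
  refine ENNReal.ofReal_le_ofReal ?_
  nlinarith

/-- Slow variation moves the weight to the shifted point at the cost of K per power; translation
invariance does the rest. -/
theorem SlowlyVarying.lintegral_shift_le {M : ℝ → ℝ} {K : ℝ≥0} {N : ℕ} (hK : SlowlyVarying M K N)
    {h : ℝ} (h0 : 0 ≤ h) (h1 : h ≤ 1) {i : ℕ} (hi : i ≤ N) (p : ℕ) (F : ℝ → ℝ≥0∞) :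
    ∫⁻ ξ, stepWeight M h ξ ^ p * F (ξ + i * h) ≤ (K : ℝ≥0∞) ^ p * ∫⁻ ξ, stepWeight M h ξ ^ p * F ξ := by
  calc _ ≤ ∫⁻ ξ, (K : ℝ≥0∞) ^ p * (stepWeight M h (ξ + i * h) ^ p * F (ξ + i * h)) := by
        refine lintegral_mono fun ξ => ?_
        rw [← mul_assoc, ← mul_pow]
        gcongr
        exact hK.stepWeight_le h0 h1 hi ξ
    _ = (K : ℝ≥0∞) ^ p * ∫⁻ ξ, stepWeight M h (ξ + i * h) ^ p * F (ξ + i * h) :=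
        lintegral_const_mul' _ _ (by finiteness)
    _ = _ := by
      rw [lintegral_add_right_eq_self (fun ξ => stepWeight M h ξ ^ p * F ξ)]

theorem SlowlyVarying.lintegral_sum_shift_le {M : ℝ → ℝ} {K : ℝ≥0} {N : ℕ}
    (hK : SlowlyVarying M K N) (hMc : Continuous M) {h : ℝ} (h0 : 0 ≤ h) (h1 : h ≤ 1) {l : ℕ}
    (hl : l ≤ N + 1) (p : ℕ) {v : ℝ → ℂ} (hv : Continuous v) :
    ∫⁻ ξ, stepWeight M h ξ ^ p * ∑ i ∈ Finset.range l, ‖v (ξ + i * h)‖ₑ ^ 2 ≤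
      l * (K : ℝ≥0∞) ^ p * ∫⁻ ξ, stepWeight M h ξ ^ p * ‖v ξ‖ₑ ^ 2 := by
  have hw := measurable_stepWeight hMc h
  have hv' := hv.measurable
  simp only [Finset.mul_sum]
  rw [lintegral_finsetSum _ fun i _ => by fun_prop]
  calc _ ≤ ∑ i ∈ Finset.range l, (K : ℝ≥0∞) ^ p * ∫⁻ ξ, stepWeight M h ξ ^ p * ‖v ξ‖ₑ ^ 2 :=
        Finset.sum_le_sum fun i hi => hK.lintegral_shift_le h0 h1
          (by have := Finset.mem_range.1 hi; omega) p fun ξ => ‖v ξ‖ₑ ^ 2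
    _ = _ := by
      rw [Finset.sum_const, Finset.card_range, nsmul_eq_mul, mul_assoc]

/-- Where `2 h M ≥ 1`, differences are controlled by values. -/
theorem enorm_fwdDiff_iter_sq_le_of_one_le {M : ℝ → ℝ} {h ξ : ℝ} (hξ : 1 ≤ 2 * (h * M ξ)) {n k : ℕ}
    (hk : k ≤ n) (g : ℝ → ℂ) :
    ‖(fwdDiff h)^[k] g ξ‖ₑ ^ 2 ≤
      (2 ^ n) ^ 2 * 2 ^ (n + 1) * 4 ^ n * (stepWeight M h ξ ^ (2 * n) *
        ∑ i ∈ Finset.range (n + 1), ‖g (ξ + i * h)‖ₑ ^ 2) := by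
  -- Here w ≥ 1/2, so the factor 4^n w^(2n) can be inserted for free.
  have hw : 1 ≤ 4 ^ n * stepWeight M h ξ ^ (2 * n) := by
    have h2 : 1 ≤ 2 * stepWeight M h ξ := by
      unfold stepWeight
      rw [mul_min]
      refine le_min (by norm_num) ?_
      rw [← ENNReal.ofReal_ofNat, ← ENNReal.ofReal_mul (by norm_num), ← ENNReal.ofReal_one]
      exact ENNReal.ofReal_le_ofReal hξ
    calc (1 : ℝ≥0∞) ≤ (2 * stepWeight M h ξ) ^ (2 * n) := one_le_pow₀ h2
      _ = _ := by rw [mul_pow, pow_mul]; norm_num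
  calc ‖(fwdDiff h)^[k] g ξ‖ₑ ^ 2
      ≤ (2 ^ k * ∑ i ∈ Finset.range (k + 1), ‖g (ξ + i * h)‖ₑ) ^ 2 := by
        gcongr
        exact enorm_fwdDiff_iter_le h k g ξ
    _ ≤ (2 ^ n * ∑ i ∈ Finset.range (n + 1), ‖g (ξ + i * h)‖ₑ) ^ 2 := by
        gcongr
        exact one_le_two
    _ ≤ (2 ^ n) ^ 2 * (2 ^ (n + 1) * ∑ i ∈ Finset.range (n + 1), ‖g (ξ + i * h)‖ₑ ^ 2) := by
        rw [mul_pow]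
        gcongr
        exact ENNReal.sq_sum_range_le _ _
    _ ≤ (4 ^ n * stepWeight M h ξ ^ (2 * n)) * ((2 ^ n) ^ 2 *
          (2 ^ (n + 1) * ∑ i ∈ Finset.range (n + 1), ‖g (ξ + i * h)‖ₑ ^ 2)) :=
        le_mul_of_one_le_left zero_le hw
    _ = _ := by ring

/-- Starts the recursion over scales: at h = 1 there is no coarser scale to compare with, but M ≥ 1
puts the whole line in the regime 2hM ≥ 1. -/
theorem SlowlyVarying.diffEnergy_le_of_one_le {M : ℝ → ℝ} {K : ℝ≥0} {n : ℕ}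
    (hK : SlowlyVarying M K n) (hMc : Continuous M) {h : ℝ} (h0 : 0 ≤ h) (h1 : h ≤ 1)
    (hM : ∀ ξ, 1 ≤ 2 * (h * M ξ)) {k : ℕ} (hk : k ≤ n) {g : ℝ → ℂ} (hg : Continuous g) :
    diffEnergy M n k h g ≤ (2 ^ n) ^ 2 * 2 ^ (n + 1) * 4 ^ n * ((n + 1 : ℕ) * (K : ℝ≥0∞) ^ (2 * n)) *
      diffEnergy M n 0 h g := by
  calc diffEnergy M n k h g ≤ ∫⁻ ξ, (2 ^ n) ^ 2 * 2 ^ (n + 1) * 4 ^ n * (stepWeight M h ξ ^ (2 * n) *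
        ∑ i ∈ Finset.range (n + 1), ‖g (ξ + i * h)‖ₑ ^ 2) := by
        refine lintegral_mono fun ξ => ?_
        exact (mul_le_of_le_one_left zero_le (pow_le_one₀ zero_le (stepWeight_le_one M h ξ))).trans
          (enorm_fwdDiff_iter_sq_le_of_one_le (hM ξ) hk g)
    _ = (2 ^ n) ^ 2 * 2 ^ (n + 1) * 4 ^ n * ∫⁻ ξ, (stepWeight M h ξ ^ (2 * n) *
        ∑ i ∈ Finset.range (n + 1), ‖g (ξ + i * h)‖ₑ ^ 2) := lintegral_const_mul' _ _ (by finiteness)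
    _ ≤ _ := by
      rw [mul_assoc _ (((n + 1 : ℕ) : ℝ≥0∞) * (K : ℝ≥0∞) ^ (2 * n))]
      gcongr
      exact hK.lintegral_sum_shift_le hMc h0 h1 le_rfl _ hg

/-- The weighted Marchaud inequality at one scale. -/
theorem SlowlyVarying.diffEnergy_le {M : ℝ → ℝ} {K : ℝ≥0} {n : ℕ}
    (hK : SlowlyVarying M K n) (hMc : Continuous M) (hM0 : ∀ ξ, 0 ≤ M ξ) {h : ℝ} (h0 : 0 ≤ h)
    (h1 : h ≤ 1) {k : ℕ} (hk : k < n) {g : ℝ → ℂ} (hg : Continuous g) :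
    diffEnergy M n k h g ≤ 2 * (4 ^ n)⁻¹ * diffEnergy M n k (2 * h) g +
      (2 * k ^ 2 * 2 ^ k * (k * (K : ℝ≥0∞) ^ (2 * (n - (k + 1)))) * diffEnergy M n (k + 1) h g +
      (2 ^ n) ^ 2 * 2 ^ (n + 1) * 4 ^ n * ((n + 1 : ℕ) * (K : ℝ≥0∞) ^ (2 * n)) *
        diffEnergy M n 0 h g) := by
  have hw := measurable_stepWeight hMc h
  have hw2 := measurable_stepWeight hMc (2 * h)
  have hgd := hg.fwdDiff_iter h (k + 1)
  have hgd2 := (hg.fwdDiff_iter (2 * h) k).measurable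
  have hsum (v : ℝ → ℂ) (hv : Measurable v) :
      Measurable fun ξ => ∑ i ∈ Finset.range k, ‖v (ξ + i * h)‖ₑ ^ 2 := by
    fun_prop
  have hsum' := hsum _ hgd.measurable
  calc diffEnergy M n k h g
      ≤ ∫⁻ ξ, (2 * (4 ^ n)⁻¹ * (stepWeight M (2 * h) ξ ^ (2 * (n - k)) *
            ‖(fwdDiff (2 * h))^[k] g ξ‖ₑ ^ 2) +
          (2 * k ^ 2 * 2 ^ k * (stepWeight M h ξ ^ (2 * (n - (k + 1))) *
            ∑ i ∈ Finset.range k, ‖(fwdDiff h)^[k + 1] g (ξ + i * h)‖ₑ ^ 2) +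
          (2 ^ n) ^ 2 * 2 ^ (n + 1) * 4 ^ n * (stepWeight M h ξ ^ (2 * n) *
            ∑ i ∈ Finset.range (n + 1), ‖g (ξ + i * h)‖ₑ ^ 2))) := by
        refine lintegral_mono fun ξ => ?_
        -- If 2hM ≥ 1 the values of g suffice. Otherwise neither the weight at h nor that at 2h is
        -- truncated, so the latter is exactly twice the former, and Marchaud's inequality applies.
        rcases le_total 1 (2 * (h * M ξ)) with hξ | hξ
        · exact ((mul_le_of_le_one_left zero_le
            (pow_le_one₀ zero_le (stepWeight_le_one M h ξ))).trans
            (enorm_fwdDiff_iter_sq_le_of_one_le hξ hk.le g)).trans (le_add_self.trans le_add_self)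
        · refine le_trans ?_ (add_le_add le_rfl le_self_add)
          have hhM : 0 ≤ h * M ξ := mul_nonneg h0 (hM0 ξ)
          have hw' : 2 * stepWeight M h ξ = stepWeight M (2 * h) ξ := by
            unfold stepWeight
            rw [min_eq_right, min_eq_right, mul_assoc 2 h,
              ENNReal.ofReal_mul (by norm_num : (0 : ℝ) ≤ 2), ENNReal.ofReal_ofNat]
            · rw [← ENNReal.ofReal_one, mul_assoc]
              exact ENNReal.ofReal_le_ofReal hξ
            · rw [← ENNReal.ofReal_one]
              exact ENNReal.ofReal_le_ofReal (by linarith)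
          have hsq : ‖(fwdDiff h)^[k] g ξ‖ₑ ^ 2 ≤
              2 * ((4 ^ k)⁻¹ * ‖(fwdDiff (2 * h))^[k] g ξ‖ₑ ^ 2) + 2 * k ^ 2 * 2 ^ k *
                ∑ i ∈ Finset.range k, ‖(fwdDiff h)^[k + 1] g (ξ + i * h)‖ₑ ^ 2 := by
            calc _ ≤ _ := pow_le_pow_left' (enorm_fwdDiff_iter_le_two_mul h k g ξ) 2
              _ ≤ _ := ENNReal.add_sq_le_two_mul _ _
              _ ≤ 2 * ((4 ^ k)⁻¹ * ‖(fwdDiff (2 * h))^[k] g ξ‖ₑ ^ 2 + k ^ 2 * (2 ^ k *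
                ∑ i ∈ Finset.range k, ‖(fwdDiff h)^[k + 1] g (ξ + i * h)‖ₑ ^ 2)) := by
                rw [mul_pow, mul_pow, ← ENNReal.inv_pow, ← pow_mul, mul_comm k 2, pow_mul]
                norm_num
                gcongr
                exact ENNReal.sq_sum_range_le _ _
              _ = _ := by ring
          have hpow : stepWeight M (2 * h) ξ ^ (2 * (n - k)) =
              4 ^ (n - k) * stepWeight M h ξ ^ (2 * (n - k)) := by
            rw [← hw', mul_pow, pow_mul 2 2]
            norm_num
          -- The squared Marchaud factor 4^(-k) and the weight ratio 4^(-(n-k)) combine to 4^(-n),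
          -- whatever k is.
          have h4 : ((4 : ℝ≥0∞) ^ n)⁻¹ * 4 ^ (n - k) = (4 ^ k)⁻¹ := by
            have : (4 : ℝ≥0∞) ^ n = 4 ^ k * 4 ^ (n - k) := by rw [← pow_add]; congr 1; omega
            rw [this, ENNReal.mul_inv (by simp) (by simp), mul_assoc,
              ENNReal.inv_mul_cancel (by simp) (by simp), mul_one]
          calc _ ≤ _ := mul_le_mul_right hsq _
            _ = 2 * (4 ^ k)⁻¹ * (stepWeight M h ξ ^ (2 * (n - k)) *
                  ‖(fwdDiff (2 * h))^[k] g ξ‖ₑ ^ 2) + 2 * k ^ 2 * 2 ^ k *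
                (stepWeight M h ξ ^ (2 * (n - k)) *
                ∑ i ∈ Finset.range k, ‖(fwdDiff h)^[k + 1] g (ξ + i * h)‖ₑ ^ 2) := by ring
            _ ≤ _ := by
              refine add_le_add (le_of_eq ?_) ?_
              · rw [hpow, ← h4]; ring
              · gcongr 2 * k ^ 2 * 2 ^ k * (?_ * _)
                exact pow_le_pow_right_of_le_one' (stepWeight_le_one M h ξ) (by omega)
    _ = 2 * (4 ^ n)⁻¹ * diffEnergy M n k (2 * h) g +
        (2 * k ^ 2 * 2 ^ k * (∫⁻ ξ, stepWeight M h ξ ^ (2 * (n - (k + 1))) *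
            ∑ i ∈ Finset.range k, ‖(fwdDiff h)^[k + 1] g (ξ + i * h)‖ₑ ^ 2) +
          (2 ^ n) ^ 2 * 2 ^ (n + 1) * 4 ^ n * ∫⁻ ξ, (stepWeight M h ξ ^ (2 * n) *
            ∑ i ∈ Finset.range (n + 1), ‖g (ξ + i * h)‖ₑ ^ 2)) := by
        rw [lintegral_add_left (by fun_prop), lintegral_add_left (by fun_prop),
          lintegral_const_mul' _ _ (by finiteness), lintegral_const_mul' _ _ (by finiteness),
          lintegral_const_mul' _ _ (by finiteness)]
        rfl
    _ ≤ _ := by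
      rw [mul_assoc _ ((k : ℝ≥0∞) * (K : ℝ≥0∞) ^ (2 * (n - (k + 1)))),
        mul_assoc _ (((n + 1 : ℕ) : ℝ≥0∞) * (K : ℝ≥0∞) ^ (2 * n))]
      refine add_le_add le_rfl (add_le_add (mul_le_mul_right ?_ _) (mul_le_mul_right ?_ _))
      · exact hK.lintegral_sum_shift_le hMc h0 h1 (by omega) _ hgd
      · exact hK.lintegral_sum_shift_le hMc h0 h1 le_rfl _ hg

/-! ### Summation over dyadic scales -/

/-- Absorption of half the sum into the left side. Induction on partial sums replaces the
subtraction, so the sum of `a` need not be known to be finite. -/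
theorem ENNReal.tsum_le_of_le_half_mul_add {a b : ℕ → ℝ≥0∞} (h0 : a 0 ≤ b 0)
    (hs : ∀ m, a (m + 1) ≤ 2⁻¹ * a m + b (m + 1)) : ∑' m, a m ≤ 2 * ∑' m, b m := by
  have h2 : (2⁻¹ : ℝ≥0∞) * 2 = 1 := ENNReal.inv_mul_cancel (by simp) (by simp)
  have key (N : ℕ) : ∑ m ∈ Finset.range N, a m ≤ 2 * ∑ m ∈ Finset.range N, b m := by
    induction N with
    | zero => simp
    | succ N ih =>
      calc ∑ m ∈ Finset.range (N + 1), a m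
          ≤ ∑ m ∈ Finset.range N, (2⁻¹ * a m + b (m + 1)) + b 0 := by
            rw [Finset.sum_range_succ']
            gcongr
            exact hs _
        _ = 2⁻¹ * ∑ m ∈ Finset.range N, a m + ∑ m ∈ Finset.range (N + 1), b m := by
            rw [Finset.sum_add_distrib, ← Finset.mul_sum, Finset.sum_range_succ' b, add_assoc]
        _ ≤ 2⁻¹ * (2 * ∑ m ∈ Finset.range N, b m) + ∑ m ∈ Finset.range (N + 1), b m := by
            gcongr
        _ ≤ ∑ m ∈ Finset.range (N + 1), b m + ∑ m ∈ Finset.range (N + 1), b m := by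
            rw [← mul_assoc, h2, one_mul]
            gcongr
            simp
        _ = _ := (two_mul _).symm
  rw [ENNReal.tsum_eq_iSup_nat]
  exact iSup_le fun N => (key N).trans (by gcongr; exact ENNReal.sum_le_tsum _)

/-- The sum of the energies over the scales `2⁻ᵐ`, weighted by `r ^ m`. -/
noncomputable def scaleEnergy (r : ℝ≥0∞) (M : ℝ → ℝ) (n k : ℕ) (g : ℝ → ℂ) : ℝ≥0∞ :=
  ∑' m : ℕ, r ^ m * diffEnergy M n k ((1 / 2) ^ m) g

/-- The one-scale inequality at h = 2^(-(m+1)) involves the same energy at 2^(-m); including the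
scale weights, its coefficient is at most 1/2 and it is absorbed. -/
theorem exists_scaleEnergy_le_succ (K : ℝ≥0) {n k : ℕ} (hk : k < n) {r : ℝ≥0∞}
    (hr : 2 * (4 ^ n)⁻¹ * r ≤ 2⁻¹) : ∃ C : ℝ≥0, ∀ M : ℝ → ℝ, Continuous M → (∀ ξ, 1 ≤ M ξ) →
      SlowlyVarying M K n → ∀ g : ℝ → ℂ, Continuous g →
      scaleEnergy r M n k g ≤ C * (scaleEnergy r M n (k + 1) g + scaleEnergy r M n 0 g) := by
  set A : ℝ≥0 := 2 * k ^ 2 * 2 ^ k * (k * K ^ (2 * (n - (k + 1)))) with hA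
  set B : ℝ≥0 := (2 ^ n) ^ 2 * 2 ^ (n + 1) * 4 ^ n * ((n + 1 : ℕ) * K ^ (2 * n)) with hB
  refine ⟨2 * (A + B), fun M hMc hM1 hK g hg => ?_⟩
  have hM0 ξ : 0 ≤ M ξ := zero_le_one.trans (hM1 ξ)
  have hle (h : ℝ) (h0 : 0 ≤ h) (h1 : h ≤ 1) :
      diffEnergy M n k h g ≤ 2 * (4 ^ n)⁻¹ * diffEnergy M n k (2 * h) g +
        (A * diffEnergy M n (k + 1) h g + B * diffEnergy M n 0 h g) := by
    refine (hK.diffEnergy_le hMc hM0 h0 h1 hk hg).trans_eq ?_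
    rw [hA, hB]
    push_cast
    rfl
  have hone : diffEnergy M n k 1 g ≤ B * diffEnergy M n 0 1 g := by
    refine (hK.diffEnergy_le_of_one_le hMc zero_le_one le_rfl (fun ξ => ?_) hk.le hg).trans_eq ?_
    · linarith [hM1 ξ]
    · rw [hB]
      push_cast
      rfl
  calc scaleEnergy r M n k g
      ≤ 2 * ∑' m : ℕ, r ^ m * (A * diffEnergy M n (k + 1) ((1 / 2) ^ m) g +
          B * diffEnergy M n 0 ((1 / 2) ^ m) g) := by
        refine ENNReal.tsum_le_of_le_half_mul_add ?_ fun m => ?_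
        · simp only [pow_zero, one_mul]
          exact hone.trans le_add_self
        · have h2 : 2 * (1 / 2 : ℝ) ^ (m + 1) = (1 / 2) ^ m := by rw [pow_succ]; ring
          have h3 := hle ((1 / 2) ^ (m + 1)) (by positivity)
            (pow_le_one₀ (by norm_num) (by norm_num))
          rw [h2] at h3
          calc _ ≤ _ := mul_le_mul_right h3 (r ^ (m + 1))
            _ = (2 * (4 ^ n)⁻¹ * r) * (r ^ m * diffEnergy M n k ((1 / 2) ^ m) g) +
              r ^ (m + 1) * (A * diffEnergy M n (k + 1) ((1 / 2) ^ (m + 1)) g +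
                B * diffEnergy M n 0 ((1 / 2) ^ (m + 1)) g) := by ring
            _ ≤ _ := by gcongr
    _ ≤ 2 * ∑' m : ℕ, ((A + B : ℝ≥0) : ℝ≥0∞) * (r ^ m * diffEnergy M n (k + 1) ((1 / 2) ^ m) g +
          r ^ m * diffEnergy M n 0 ((1 / 2) ^ m) g) := by
        refine mul_le_mul_right (ENNReal.tsum_le_tsum fun m => ?_) _
        rw [← mul_add, mul_left_comm]
        refine mul_le_mul_right ?_ _
        rw [mul_add]
        push_cast
        gcongr
        · exact le_self_add
        · exact le_add_self
    _ = _ := by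
        rw [ENNReal.tsum_mul_left, ENNReal.tsum_add, ← mul_assoc]
        push_cast
        rfl

/-- Descends from k = n one order at a time. The constant is chosen before M, which later makes it
uniform in t. -/
theorem exists_scaleEnergy_le (K : ℝ≥0) (n : ℕ) {r : ℝ≥0∞}
    (hr : 2 * (4 ^ n)⁻¹ * r ≤ 2⁻¹) : ∃ C : ℝ≥0, ∀ M : ℝ → ℝ, Continuous M → (∀ ξ, 1 ≤ M ξ) →
      SlowlyVarying M K n → ∀ g : ℝ → ℂ, Continuous g → ∀ k ≤ n,
      scaleEnergy r M n k g ≤ C * (scaleEnergy r M n n g + scaleEnergy r M n 0 g) := by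
  have key (j : ℕ) (hj : j ≤ n) : ∃ C : ℝ≥0, ∀ M : ℝ → ℝ, Continuous M → (∀ ξ, 1 ≤ M ξ) →
      SlowlyVarying M K n → ∀ g : ℝ → ℂ, Continuous g →
      scaleEnergy r M n (n - j) g ≤ C * (scaleEnergy r M n n g + scaleEnergy r M n 0 g) := by
    induction j with
    | zero => exact ⟨1, fun M _ _ _ g _ => by simp⟩
    | succ j ih =>
      obtain ⟨C₁, hC₁⟩ := ih (by omega)
      obtain ⟨C₂, hC₂⟩ := exists_scaleEnergy_le_succ K (k := n - (j + 1)) (by omega) hr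
      refine ⟨C₂ * (C₁ + 1), fun M hMc hM1 hK g hg => (hC₂ M hMc hM1 hK g hg).trans ?_⟩
      have h1 : n - (j + 1) + 1 = n - j := by omega
      rw [h1, ENNReal.coe_mul, mul_assoc]
      refine mul_le_mul_right ?_ _
      rw [ENNReal.coe_add, ENNReal.coe_one, add_mul, one_mul]
      exact add_le_add (hC₁ M hMc hM1 hK g hg) le_add_self
  choose! C hC using key
  refine ⟨∑ j ∈ Finset.range (n + 1), C j, fun M hMc hM1 hK g hg k hk => ?_⟩
  have h1 := hC (n - k) (by omega) M hMc hM1 hK g hg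
  rw [Nat.sub_sub_self hk] at h1
  refine h1.trans (mul_le_mul_left ?_ _)
  exact_mod_cast Finset.single_le_sum (f := C) (fun _ _ => zero_le) (Finset.mem_range.2 (by omega))

/-- The terms grow like 4^(sm) while 2^m ≤ x and decay like 4^((s-n)m) afterwards, so the sum is
comparable to its value at the turning point 2^m ≈ x. -/
theorem exists_tsum_pow_mul_min_le {s : ℝ} (hs : 0 < s) {n : ℕ} (hn : s < n) :
    ∃ C : ℝ≥0, ∀ x : ℝ, 0 ≤ x →
      ∑' m : ℕ, ENNReal.ofReal (4 ^ s) ^ m * min 1 (ENNReal.ofReal ((1 / 2) ^ m * x)) ^ (2 * n) ≤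
        C * ENNReal.ofReal (x ^ (2 * s)) := by
  have hn0 : n ≠ 0 := by
    rintro rfl
    simp at hn
    linarith
  set p : ℝ := 4 ^ s with hp
  have hp1 : 1 < p := Real.one_lt_rpow (by norm_num) hs
  have hp0 : 0 < p := by positivity
  set q : ℝ := p / 4 ^ n with hq
  have hq0 : 0 < q := by positivity
  have hq1 : q < 1 := by
    rw [hq, div_lt_one (by positivity), hp, ← Real.rpow_natCast]
    exact Real.rpow_lt_rpow_of_exponent_lt (by norm_num) hn
  -- The profile in j = m - k, where 2^k ≤ x < 2^(k+1): p > 1 makes it summable at -∞, and q < 1 at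
  -- +∞.
  set G : ℤ → ℝ := fun j => min (p ^ j) (q ^ j) with hG
  have hG0 j : 0 ≤ G j := by positivity
  have hsum : Summable G := by
    refine Summable.of_nat_of_neg ?_ ?_
    · refine Summable.of_nonneg_of_le (fun j => hG0 _) (fun j => ?_)
        (summable_geometric_of_lt_one hq0.le hq1)
      simp [hG]
    · refine Summable.of_nonneg_of_le (fun j => hG0 _) (fun j => ?_)
        (summable_geometric_of_lt_one (r := p⁻¹) (by positivity) (inv_lt_one_of_one_lt₀ hp1))
      simp [hG]
  refine ⟨(4 ^ n * ∑' j, G j).toNNReal, fun x hx => ?_⟩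
  rcases hx.eq_or_lt with rfl | hx
  · simp [hn0]
  obtain ⟨k, hk1, hk2⟩ := exists_mem_Ico_zpow hx one_lt_two
  have hterm (m : ℕ) : ENNReal.ofReal p ^ m *
      min 1 (ENNReal.ofReal ((1 / 2) ^ m * x)) ^ (2 * n) ≤
      ENNReal.ofReal (4 ^ n * x ^ (2 * s)) * ENNReal.ofReal (G (m - k)) := by
    rw [← ENNReal.ofReal_one, ← ENNReal.ofReal_min,
      ← ENNReal.ofReal_pow (by positivity), ← ENNReal.ofReal_pow (by positivity),
      ← ENNReal.ofReal_mul (by positivity), ← ENNReal.ofReal_mul (by positivity)]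
    refine ENNReal.ofReal_le_ofReal ?_
    have hpk : p ^ k ≤ x ^ (2 * s) := by
      calc p ^ k = ((2 : ℝ) ^ k) ^ (2 * s) := by
            rw [hp, ← Real.rpow_intCast, ← Real.rpow_intCast, ← Real.rpow_mul (by norm_num),
              ← Real.rpow_mul (by norm_num), show (4 : ℝ) = 2 ^ (2 : ℝ) by norm_num,
              ← Real.rpow_mul (by norm_num)]
            ring_nf
        _ ≤ _ := Real.rpow_le_rpow (by positivity) hk1 (by positivity)
    have hpm : p ^ m ≤ x ^ (2 * s) * p ^ ((m : ℤ) - k) := by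
      calc p ^ m = p ^ k * p ^ ((m : ℤ) - k) := by
            rw [← zpow_add₀ hp0.ne', ← zpow_natCast]
            congr 1
            ring
        _ ≤ _ := by gcongr
    have h4 : (1 : ℝ) ≤ 4 ^ n := one_le_pow₀ (by norm_num)
    rw [hG, mul_min_of_nonneg _ _ (by positivity)]
    refine le_min ?_ ?_
    · calc _ ≤ p ^ m * 1 := by
            gcongr
            exact pow_le_one₀ (by positivity) (min_le_left _ _)
        _ ≤ x ^ (2 * s) * p ^ ((m : ℤ) - k) := by rwa [mul_one]
        _ ≤ 4 ^ n * (x ^ (2 * s) * p ^ ((m : ℤ) - k)) := le_mul_of_one_le_left (by positivity) h4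
        _ = _ := by ring
    · have hmin : min 1 ((1 / 2) ^ m * x) ≤ 2 * (2 : ℝ) ^ (k - m) := by
        refine (min_le_right _ _).trans ?_
        calc (1 / 2 : ℝ) ^ m * x ≤ (1 / 2 : ℝ) ^ m * 2 ^ (k + 1) := by gcongr
          _ = _ := by
            rw [zpow_add₀ two_ne_zero, zpow_sub₀ two_ne_zero, zpow_natCast, one_div, inv_pow]
            field_simp
      calc _ ≤ (x ^ (2 * s) * p ^ ((m : ℤ) - k)) * (2 * (2 : ℝ) ^ (k - m)) ^ (2 * n) := by gcongr
        _ = _ := by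
          have : ((2 : ℝ) * 2 ^ (k - m)) ^ (2 * n) = 4 ^ n * ((4 ^ n) ^ ((m : ℤ) - k))⁻¹ := by
            rw [mul_pow, pow_mul, ← zpow_neg, neg_sub]
            norm_num
            rw [show (4 : ℝ) = 2 ^ 2 by norm_num, ← pow_mul, ← zpow_natCast, ← zpow_natCast,
              ← zpow_mul, ← zpow_mul, mul_comm]
          rw [this, hq, div_zpow]
          ring
  calc _ ≤ ∑' m : ℕ, ENNReal.ofReal (4 ^ n * x ^ (2 * s)) * ENNReal.ofReal (G (m - k)) :=
        ENNReal.tsum_le_tsum hterm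
    _ = ENNReal.ofReal (4 ^ n * x ^ (2 * s)) * ∑' m : ℕ, ENNReal.ofReal (G (m - k)) :=
        ENNReal.tsum_mul_left
    _ ≤ ENNReal.ofReal (4 ^ n * x ^ (2 * s)) * ∑' j : ℤ, ENNReal.ofReal (G j) := by
        gcongr
        refine ENNReal.tsum_comp_le_tsum_of_injective (f := fun m : ℕ => (m : ℤ) - k) ?_
          fun j => ENNReal.ofReal (G j)
        intro a b hab
        simpa using hab
    _ = _ := by
        have h0 : 0 ≤ ∑' j, G j := tsum_nonneg hG0
        rw [← ENNReal.ofReal_tsum_of_nonneg hG0 hsum, ← ENNReal.ofReal, ← ENNReal.ofReal_mul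
          (by positivity), ← ENNReal.ofReal_mul (by positivity)]
        ring_nf

/-! ### Comparison of `|x| ^ (2 s)` with dyadic sums of differences of characters -/

theorem enorm_exp_sub_one_eq (θ : ℝ) :
    ‖Complex.exp (θ * Complex.I) - 1‖ₑ = ENNReal.ofReal (2 * |Real.sin (θ / 2)|) := by
  rw [← ofReal_norm, mul_comm, Complex.norm_exp_I_mul_ofReal_sub_one]
  simp

/-- The 1 covers |x| ≤ 1/2. For larger x one term is enough: at the scale where 2^(-m)|x| lies
between 1/4 and 1/2 the character is at distance at least 1 from 1, and 4^(sm) ≥ |x|^(2s). -/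
theorem rpow_le_one_add_tsum {s : ℝ} (hs : 0 < s) (n : ℕ) (x : ℝ) :
    ENNReal.ofReal (|x| ^ (2 * s)) ≤ 1 + ∑' m : ℕ, ENNReal.ofReal (4 ^ s) ^ m *
      ‖Complex.exp ((-2 * Real.pi * ((1 / 2) ^ m * x) : ℝ) * Complex.I) - 1‖ₑ ^ (2 * n) := by
  rcases le_total (2 * |x|) 1 with hx | hx
  · refine le_trans ?_ le_self_add
    rw [← ENNReal.ofReal_one]
    exact ENNReal.ofReal_le_ofReal
      (Real.rpow_le_one (abs_nonneg x) (by linarith [abs_nonneg x]) (by positivity))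
  · obtain ⟨k, hk1, hk2⟩ := exists_nat_pow_near hx one_lt_two
    refine le_trans ?_ le_add_self
    refine le_trans ?_ (ENNReal.le_tsum (k + 1))
    have hr : ENNReal.ofReal (|x| ^ (2 * s)) ≤ ENNReal.ofReal (4 ^ s) ^ (k + 1) := by
      rw [← ENNReal.ofReal_pow (by positivity)]
      refine ENNReal.ofReal_le_ofReal ?_
      calc |x| ^ (2 * s) ≤ ((2 : ℝ) ^ (k + 1)) ^ (2 * s) :=
            Real.rpow_le_rpow (abs_nonneg x) (by linarith) (by positivity)
        _ = _ := by
          rw [show (4 : ℝ) = 2 ^ (2 : ℝ) by norm_num, ← Real.rpow_natCast, ← Real.rpow_natCast,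
            ← Real.rpow_mul (by norm_num), ← Real.rpow_mul (by norm_num),
            ← Real.rpow_mul (by norm_num)]
          ring_nf
    refine hr.trans (le_mul_of_one_le_right zero_le (one_le_pow₀ ?_))
    rw [enorm_exp_sub_one_eq, ← ENNReal.ofReal_one]
    refine ENNReal.ofReal_le_ofReal ?_
    have hy : |(-2 * Real.pi * ((1 / 2) ^ (k + 1) * x)) / 2| = Real.pi * ((1 / 2) ^ (k + 1) * |x|) := by
      rw [show (-2 * Real.pi * ((1 / 2) ^ (k + 1) * x)) / 2 = -(Real.pi * ((1 / 2) ^ (k + 1) * x)) by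
        ring, abs_neg, abs_mul, abs_mul, abs_of_pos Real.pi_pos, abs_of_pos (by positivity)]
    have hhi : (1 / 2 : ℝ) ^ (k + 1) * |x| ≤ 1 / 2 := by
      calc (1 / 2 : ℝ) ^ (k + 1) * |x| ≤ (1 / 2 : ℝ) ^ (k + 1) * (2 ^ (k + 1) / 2) := by
            gcongr; linarith
        _ = 1 / 2 := by rw [one_div, inv_pow]; field_simp
    have hlo : 1 / 4 ≤ (1 / 2 : ℝ) ^ (k + 1) * |x| := by
      calc (1 / 4 : ℝ) = (1 / 2 : ℝ) ^ (k + 1) * (2 ^ k / 2) := by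
            rw [one_div_pow, pow_succ]; field_simp; norm_num
        _ ≤ _ := by gcongr; linarith
    -- Jordan's inequality |sin θ| ≥ 2|θ|/π for |θ| ≤ π/2.
    have hsin := Real.mul_abs_le_abs_sin (x := (-2 * Real.pi * ((1 / 2) ^ (k + 1) * x)) / 2)
      (by rw [hy]; nlinarith [Real.pi_pos])
    rw [hy, ← mul_assoc, div_mul_cancel₀ _ Real.pi_ne_zero] at hsin
    linarith

/-- |exp(iθ) - 1| ≤ min(2, |θ|) reduces this to the dyadic sum `exists_tsum_pow_mul_min_le`. -/
theorem exists_tsum_enorm_exp_sub_one_le {s : ℝ} (hs : 0 < s) {n : ℕ} (hn : s < n) :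
    ∃ C : ℝ≥0, ∀ x : ℝ, ∑' m : ℕ, ENNReal.ofReal (4 ^ s) ^ m *
      ‖Complex.exp ((-2 * Real.pi * ((1 / 2) ^ m * x) : ℝ) * Complex.I) - 1‖ₑ ^ (2 * n) ≤
        C * ENNReal.ofReal (|x| ^ (2 * s)) := by
  obtain ⟨C, hC⟩ := exists_tsum_pow_mul_min_le hs hn
  obtain ⟨P, hpi⟩ : ∃ P : ℝ≥0, ENNReal.ofReal (2 * Real.pi) = P := ⟨_, rfl⟩
  refine ⟨P ^ (2 * n) * C, fun x => ?_⟩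
  calc _ ≤ ∑' m : ℕ, (P : ℝ≥0∞) ^ (2 * n) * (ENNReal.ofReal (4 ^ s) ^ m *
        min 1 (ENNReal.ofReal ((1 / 2) ^ m * |x|)) ^ (2 * n)) := by
        refine ENNReal.tsum_le_tsum fun m => ?_
        rw [mul_left_comm ((P : ℝ≥0∞) ^ (2 * n)), ← mul_pow]
        gcongr
        rw [enorm_exp_sub_one_eq, ← ENNReal.ofReal_one, ← ENNReal.ofReal_min, ← hpi,
          ← ENNReal.ofReal_mul (by positivity)]
        refine ENNReal.ofReal_le_ofReal ?_
        rw [mul_min_of_nonneg _ _ (by positivity)]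
        refine le_min ?_ ?_
        · nlinarith [Real.abs_sin_le_one (-2 * Real.pi * ((1 / 2) ^ m * x) / 2), Real.pi_gt_three]
        · have h1 := Real.abs_sin_le_abs (x := -2 * Real.pi * ((1 / 2) ^ m * x) / 2)
          rw [show (-2 * Real.pi * ((1 / 2) ^ m * x)) / 2 = -(Real.pi * ((1 / 2) ^ m * x)) by
            ring, abs_neg (Real.pi * _), abs_mul, abs_mul, abs_of_pos Real.pi_pos,
            abs_of_pos (show (0 : ℝ) < (1 / 2) ^ m by positivity)] at h1
          rw [show (-2 * Real.pi * ((1 / 2) ^ m * x)) / 2 = -(Real.pi * ((1 / 2) ^ m * x)) by ring]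
          linarith
    _ = (P : ℝ≥0∞) ^ (2 * n) * ∑' m : ℕ, (ENNReal.ofReal (4 ^ s) ^ m *
        min 1 (ENNReal.ofReal ((1 / 2) ^ m * |x|)) ^ (2 * n)) := ENNReal.tsum_mul_left
    _ ≤ _ := by
        rw [ENNReal.coe_mul, ENNReal.coe_pow, mul_assoc]
        gcongr
        exact hC _ (abs_nonneg x)

/-! ### Multipliers that extend to entire functions -/

/-- Induction with the mean value inequality, since Δ_h commutes with differentiation. -/
theorem norm_fwdDiff_iter_le_of_iteratedDeriv {h : ℝ} (h0 : 0 ≤ h) (j : ℕ) {a : ℝ → ℂ}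
    (ha : ContDiff ℝ ∞ a) (ξ B : ℝ)
    (hB : ∀ x ∈ Set.Icc ξ (ξ + j * h), ‖iteratedDeriv j a x‖ ≤ B) :
    ‖(fwdDiff h)^[j] a ξ‖ ≤ h ^ j * B := by
  induction j generalizing a B with
  | zero => simpa using hB ξ (by simp)
  | succ j ih =>
    have hsh : ContDiff ℝ ∞ fun x => a (x + h) := by fun_prop
    have hd : ContDiff ℝ ∞ (fwdDiff h a) := hsh.sub ha
    have hdiff : Differentiable ℝ (iteratedDeriv j a) :=
      ha.differentiable_iteratedDeriv j (by exact_mod_cast ENat.natCast_lt_top j)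
    rw [Function.iterate_succ_apply, pow_succ, mul_assoc]
    refine ih hd (h * B) fun x hx => ?_
    have h1 : iteratedDeriv j (fwdDiff h a) x = iteratedDeriv j a (x + h) - iteratedDeriv j a x := by
      have : fwdDiff h a = (fun x => a (x + h)) - a := rfl
      rw [this, iteratedDeriv_sub (hsh.contDiffAt.of_le (by exact_mod_cast le_top))
        (ha.contDiffAt.of_le (by exact_mod_cast le_top)), iteratedDeriv_comp_add_const]
    have hx' : Set.Icc x (x + h) ⊆ Set.Icc ξ (ξ + (j + 1 : ℕ) * h) := by
      refine Set.Icc_subset_Icc hx.1 ?_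
      have := hx.2
      push_cast
      linarith
    have h2 := (convex_Icc x (x + h)).norm_image_sub_le_of_norm_deriv_le (𝕜 := ℝ)
      (f := iteratedDeriv j a) (C := B) (fun y _ => hdiff y)
      (fun y hy => by rw [← iteratedDeriv_succ]; exact hB y (hx' hy))
      (Set.left_mem_Icc.2 (by linarith)) (Set.right_mem_Icc.2 (by linarith))
    rw [h1, mul_comm]
    simpa [abs_of_nonneg h0] using h2

theorem contDiff_comp_ofReal {A : ℂ → ℂ} (hA : Differentiable ℂ A) :
    ContDiff ℝ ∞ fun x : ℝ => A x :=
  (hA.contDiff.restrict_scalars ℝ).comp Complex.ofRealCLM.contDiff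

theorem iteratedDeriv_comp_ofReal {A : ℂ → ℂ} (hA : Differentiable ℂ A) (j : ℕ) :
    iteratedDeriv j (fun x : ℝ => A x) = fun x : ℝ => iteratedDeriv j A x := by
  induction j with
  | zero => simp
  | succ j ih =>
    have hd : Differentiable ℂ (iteratedDeriv j A) :=
      (hA.contDiff (n := ∞)).differentiable_iteratedDeriv j (by exact_mod_cast ENat.natCast_lt_top j)
    ext x
    rw [iteratedDeriv_succ, ih, iteratedDeriv_succ]
    exact ((hd x).hasDerivAt.comp_ofReal).deriv

/-- `A` is entire and bounded by `C` at distance at most `1 / M(ξ)` from each real `ξ`. -/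
structure EntireMultiplier (A : ℂ → ℂ) (M : ℝ → ℝ) (C : ℝ≥0) : Prop where
  differentiable : Differentiable ℂ A
  norm_le : ∀ (ξ : ℝ) (z : ℂ), ‖z - ξ‖ * M ξ ≤ 1 → ‖A z‖ ≤ C

/-- Cauchy's estimate on the circle of radius 1/M(ξ). -/
theorem EntireMultiplier.norm_iteratedDeriv_le {A : ℂ → ℂ} {M : ℝ → ℝ} {C : ℝ≥0}
    (hA : EntireMultiplier A M C) (hM : ∀ ξ, 0 < M ξ) (j : ℕ) (ξ : ℝ) :
    ‖iteratedDeriv j (fun x : ℝ => A x) ξ‖ ≤ j.factorial * C * M ξ ^ j := by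
  rw [iteratedDeriv_comp_ofReal hA.differentiable]
  refine (Complex.norm_iteratedDeriv_le_of_forall_mem_sphere_norm_le j
    (inv_pos.2 (hM ξ)) hA.differentiable.diffContOnCl fun z hz => hA.norm_le ξ z ?_).trans_eq ?_
  · rw [mem_sphere_iff_norm] at hz
    rw [hz, inv_mul_cancel₀ (hM ξ).ne']
  · rw [inv_pow, div_inv_eq_mul]

theorem EntireMultiplier.hasTemperateGrowth {A : ℂ → ℂ} {M : ℝ → ℝ} {C : ℝ≥0}
    (hA : EntireMultiplier A M C) (hM : ∀ ξ, 0 < M ξ) {D : ℝ} {p : ℕ}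
    (hMD : ∀ ξ, M ξ ≤ D * (1 + ‖ξ‖) ^ p) :
    Function.HasTemperateGrowth fun x : ℝ => A x := by
  refine ⟨contDiff_comp_ofReal hA.differentiable, fun j =>
    ⟨p * j, j.factorial * C * D ^ j, fun ξ => ?_⟩⟩
  rw [norm_iteratedFDeriv_eq_norm_iteratedDeriv]
  refine (hA.norm_iteratedDeriv_le hM j ξ).trans ?_
  rw [pow_mul, mul_assoc _ (D ^ j), ← mul_pow]
  gcongr
  · exact (hM ξ).le
  · exact hMD ξ

/-- For hM ≥ 1 the bound on the values of A suffices. For hM ≤ 1 the mean value and Cauchy estimates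
give (hM)^j, slow variation bringing M back to the base point. The constant is the sum of those of
the two regimes. -/
theorem EntireMultiplier.enorm_fwdDiff_iter_le {A : ℂ → ℂ} {M : ℝ → ℝ} {C : ℝ≥0}
    (hA : EntireMultiplier A M C) (hM : ∀ ξ, 0 < M ξ) {K : ℝ≥0} {N : ℕ} (hK : SlowlyVarying M K N)
    {h : ℝ} (h0 : 0 ≤ h) (h1 : h ≤ 1) {j : ℕ} (hj : j ≤ N) (ξ : ℝ) :
    ‖(fwdDiff h)^[j] (fun x : ℝ => A x) ξ‖ₑ ≤
      ((2 ^ N * (N + 1) + N.factorial * K ^ N) * C : ℝ≥0) * stepWeight M h ξ ^ j := by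
  rcases le_total 1 (h * M ξ) with hξ | hξ
  · have hw : stepWeight M h ξ = 1 := by
      unfold stepWeight
      rw [min_eq_left]
      rw [← ENNReal.ofReal_one]
      exact ENNReal.ofReal_le_ofReal hξ
    have hb (x : ℝ) : ‖A x‖ₑ ≤ C := by
      have := hA.norm_le x x (by simp)
      rw [enorm_eq_nnnorm]
      exact_mod_cast this
    rw [hw, one_pow, mul_one]
    have h2 := _root_.enorm_fwdDiff_iter_le h j (fun x : ℝ => A x) ξ
    refine h2.trans ?_
    calc _ ≤ 2 ^ N * ∑ i ∈ Finset.range (N + 1), (C : ℝ≥0∞) := by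
          gcongr
          · exact one_le_two
          · refine (Finset.sum_le_sum fun i _ => hb _).trans
              (Finset.sum_le_sum_of_subset (Finset.range_mono (by omega)))
      _ = ((2 ^ N * (N + 1)) * C : ℝ≥0) := by
          rw [Finset.sum_const, Finset.card_range, nsmul_eq_mul]
          push_cast
          ring
      _ ≤ _ := by
          refine ENNReal.coe_le_coe.2 ?_
          gcongr
          exact le_self_add
  · have hw : stepWeight M h ξ = ENNReal.ofReal (h * M ξ) := by
      unfold stepWeight
      rw [min_eq_right]
      rw [← ENNReal.ofReal_one]
      exact ENNReal.ofReal_le_ofReal hξ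
    have h2 := norm_fwdDiff_iter_le_of_iteratedDeriv h0 j (contDiff_comp_ofReal hA.differentiable) ξ
      (N.factorial * C * (K * M ξ) ^ j) fun x hx => by
        refine (hA.norm_iteratedDeriv_le hM j x).trans ?_
        have hjN : (j : ℝ) ≤ N := by exact_mod_cast hj
        have h3 := hK.2 x (ξ - x) (by
          rw [abs_le]
          have := hx.1
          have := hx.2
          constructor <;> nlinarith)
        rw [add_sub_cancel] at h3
        exact mul_le_mul (mul_le_mul_of_nonneg_right (by exact_mod_cast Nat.factorial_le hj)
          C.coe_nonneg) (pow_le_pow_left₀ (hM x).le h3 j) (pow_nonneg (hM x).le j) (by positivity)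
    rw [hw, ← ofReal_norm, ← ENNReal.ofReal_coe_nnreal, ← ENNReal.ofReal_pow (by
      have := hM ξ; positivity), ← ENNReal.ofReal_mul (NNReal.coe_nonneg _)]
    refine ENNReal.ofReal_le_ofReal (h2.trans ?_)
    have hKj : (K : ℝ) ^ j ≤ K ^ N := pow_le_pow_right₀ (by exact_mod_cast hK.1) hj
    have hMξ := hM ξ
    calc _ = N.factorial * (K : ℝ) ^ j * C * (h * M ξ) ^ j := by ring
      _ ≤ N.factorial * (K : ℝ) ^ N * C * (h * M ξ) ^ j := by gcongr
      _ ≤ _ := by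
        push_cast
        gcongr
        exact le_add_of_nonneg_left (by positivity)

/-- In the Leibniz rule, i differences falling on A yield w^i, exactly the weight that `diffEnergy`
gives to the remaining k = n - i differences of g. -/
theorem EntireMultiplier.diffEnergy_mul_le {A : ℂ → ℂ} {M : ℝ → ℝ} {C : ℝ≥0}
    (hA : EntireMultiplier A M C) (hMc : Continuous M) (hM : ∀ ξ, 0 < M ξ) {K : ℝ≥0} {n : ℕ}
    (hK : SlowlyVarying M K n) {h : ℝ} (h0 : 0 ≤ h) (h1 : h ≤ 1) {g : ℝ → ℂ} (hg : Continuous g) :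
    diffEnergy M n n h (fun ξ => A ξ * g ξ) ≤
      ((2 ^ n * ((2 ^ n * (n + 1) + n.factorial * K ^ n) * C)) ^ 2 * 2 ^ (n + 1) *
        K ^ (2 * n) : ℝ≥0) * ∑ k ∈ Finset.range (n + 1), diffEnergy M n k h g := by
  set D : ℝ≥0 := (2 ^ n * (n + 1) + n.factorial * K ^ n) * C with hD
  have hw := measurable_stepWeight hMc h
  have hpt (ξ : ℝ) : ‖(fwdDiff h)^[n] (fun ξ : ℝ => A ξ * g ξ) ξ‖ₑ ≤
      2 ^ n * (D * ∑ i ∈ Finset.range (n + 1),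
        stepWeight M h ξ ^ i * ‖(fwdDiff h)^[n - i] g (ξ + i * h)‖ₑ) := by
    refine enorm_fwdDiff_iter_mul_le h n (fun ξ : ℝ => A ξ) g ξ _ fun i j hij => ?_
    have hj : n - i = j := by omega
    calc _ ≤ (D * stepWeight M h ξ ^ i) * ‖(fwdDiff h)^[j] g (ξ + i * h)‖ₑ := by
          gcongr
          exact hA.enorm_fwdDiff_iter_le hM hK h0 h1 (by omega) ξ
      _ ≤ _ := by
        rw [mul_assoc, ← hj]
        gcongr
        exact Finset.single_le_sum
          (f := fun i => stepWeight M h ξ ^ i * ‖(fwdDiff h)^[n - i] g (ξ + i * h)‖ₑ)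
          (fun _ _ => zero_le) (Finset.mem_range.2 (by omega))
  have hmeas (i : ℕ) : Measurable fun ξ =>
      stepWeight M h ξ ^ (2 * i) * ‖(fwdDiff h)^[n - i] g (ξ + i * h)‖ₑ ^ 2 := by
    have hm (v : ℝ → ℂ) (hv : Measurable v) : Measurable fun ξ =>
        stepWeight M h ξ ^ (2 * i) * ‖v (ξ + i * h)‖ₑ ^ 2 := by fun_prop
    exact hm _ (hg.fwdDiff_iter h (n - i)).measurable
  calc diffEnergy M n n h (fun ξ => A ξ * g ξ)
      ≤ ∫⁻ ξ, (2 ^ n * D : ℝ≥0∞) ^ 2 * 2 ^ (n + 1) * ∑ i ∈ Finset.range (n + 1),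
          stepWeight M h ξ ^ (2 * i) * ‖(fwdDiff h)^[n - i] g (ξ + i * h)‖ₑ ^ 2 := by
        refine lintegral_mono fun ξ => ?_
        simp only [Nat.sub_self, mul_zero, pow_zero, one_mul]
        calc _ ≤ _ := pow_le_pow_left' (hpt ξ) 2
          _ ≤ (2 ^ n * D : ℝ≥0∞) ^ 2 * (2 ^ (n + 1) * ∑ i ∈ Finset.range (n + 1),
              (stepWeight M h ξ ^ i * ‖(fwdDiff h)^[n - i] g (ξ + i * h)‖ₑ) ^ 2) := by
            rw [← mul_assoc, mul_pow]
            gcongr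
            exact ENNReal.sq_sum_range_le _ _
          _ = _ := by simp only [mul_pow, ← pow_mul, mul_comm 2, mul_assoc]
    _ = (2 ^ n * D : ℝ≥0∞) ^ 2 * 2 ^ (n + 1) * ∑ i ∈ Finset.range (n + 1),
          ∫⁻ ξ, stepWeight M h ξ ^ (2 * i) * ‖(fwdDiff h)^[n - i] g (ξ + i * h)‖ₑ ^ 2 := by
        rw [lintegral_const_mul' _ _ (by finiteness), lintegral_finsetSum _ fun i _ => hmeas i]
    _ ≤ (2 ^ n * D : ℝ≥0∞) ^ 2 * 2 ^ (n + 1) * ∑ i ∈ Finset.range (n + 1),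
          (K : ℝ≥0∞) ^ (2 * n) * diffEnergy M n (n - i) h g := by
        gcongr with i hi
        have hi' : i ≤ n := by have := Finset.mem_range.1 hi; omega
        refine (hK.lintegral_shift_le h0 h1 hi' (2 * i)
          fun ξ => ‖(fwdDiff h)^[n - i] g ξ‖ₑ ^ 2).trans ?_
        rw [diffEnergy, Nat.sub_sub_self hi']
        gcongr
        exact_mod_cast hK.1
    _ = _ := by
        rw [← Finset.mul_sum, ← Finset.sum_range_reflect (fun k => diffEnergy M n k h g)]
        push_cast
        ring

theorem exists_scaleEnergy_zero_le {s : ℝ} (hs : 0 < s) {n : ℕ} (hn : s < n) :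
    ∃ C : ℝ≥0, ∀ M : ℝ → ℝ, Continuous M → (∀ ξ, 0 ≤ M ξ) → ∀ g : ℝ → ℂ, Continuous g →
      scaleEnergy (ENNReal.ofReal (4 ^ s)) M n 0 g ≤
        C * ∫⁻ ξ, ENNReal.ofReal (M ξ ^ (2 * s)) * ‖g ξ‖ₑ ^ 2 := by
  obtain ⟨C, hC⟩ := exists_tsum_pow_mul_min_le hs hn
  refine ⟨C, fun M hMc hM g hg => ?_⟩
  have hw (m : ℕ) := measurable_stepWeight hMc ((1 / 2) ^ m)
  have hg' := hg.measurable
  calc scaleEnergy (ENNReal.ofReal (4 ^ s)) M n 0 g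
      = ∫⁻ ξ, ∑' m : ℕ, ENNReal.ofReal (4 ^ s) ^ m *
          (stepWeight M ((1 / 2) ^ m) ξ ^ (2 * n) * ‖g ξ‖ₑ ^ 2) := by
        rw [lintegral_tsum fun m => by have := hw m; fun_prop]
        refine tsum_congr fun m => ?_
        rw [lintegral_const_mul' _ _ (by finiteness)]
        rfl
    _ ≤ ∫⁻ ξ, C * (ENNReal.ofReal (M ξ ^ (2 * s)) * ‖g ξ‖ₑ ^ 2) := by
        refine lintegral_mono fun ξ => ?_
        simp only [← mul_assoc]
        rw [ENNReal.tsum_mul_right]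
        gcongr
        exact hC _ (hM ξ)
    _ = _ := lintegral_const_mul' _ _ (by finiteness)

/-- Multiplication by `A` is bounded in the difference norm of order `s`, up to a loss of `M ^ s`. -/
theorem exists_scaleEnergy_mul_le {s : ℝ} (hs : 0 < s) {n : ℕ} (hn : s + 1 ≤ n) (K C₀ : ℝ≥0) :
    ∃ C : ℝ≥0, ∀ (A : ℂ → ℂ) (M : ℝ → ℝ), EntireMultiplier A M C₀ → Continuous M →
      (∀ ξ, 1 ≤ M ξ) → SlowlyVarying M K n → ∀ g : ℝ → ℂ, Continuous g →
      scaleEnergy (ENNReal.ofReal (4 ^ s)) M n n (fun ξ => A ξ * g ξ) ≤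
        C * (scaleEnergy (ENNReal.ofReal (4 ^ s)) M n n g +
          ∫⁻ ξ, ENNReal.ofReal (M ξ ^ (2 * s)) * ‖g ξ‖ₑ ^ 2) := by
  set r := ENNReal.ofReal (4 ^ s) with hr
  -- This is where n ≥ s + 1, rather than n > s, enters: 4^s ≤ 4^(n-1).
  have hrn : 2 * (4 ^ n)⁻¹ * r ≤ 2⁻¹ := by
    have h4 : r ≤ 4 ^ n * 4⁻¹ := by
      rw [hr, show (4 ^ n * 4⁻¹ : ℝ≥0∞) = ENNReal.ofReal (4 ^ n * 4⁻¹) by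
        rw [ENNReal.ofReal_mul (by positivity), ENNReal.ofReal_pow (by norm_num),
          ENNReal.ofReal_inv_of_pos (by norm_num)]
        norm_num]
      refine ENNReal.ofReal_le_ofReal ?_
      calc (4 : ℝ) ^ s ≤ 4 ^ ((n : ℝ) - 1) :=
            Real.rpow_le_rpow_of_exponent_le (by norm_num) (by linarith)
        _ = _ := by rw [Real.rpow_sub_one (by norm_num), Real.rpow_natCast, div_eq_mul_inv]
    calc 2 * (4 ^ n)⁻¹ * r ≤ 2 * (4 ^ n)⁻¹ * (4 ^ n * 4⁻¹) := by gcongr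
      _ = 2 * 4⁻¹ := by
        rw [mul_assoc, ← mul_assoc _ _ (4⁻¹ : ℝ≥0∞), ENNReal.inv_mul_cancel (by simp) (by simp),
          one_mul]
      _ = 2⁻¹ := by
        rw [show (4 : ℝ≥0∞) = 2 * 2 by norm_num, ENNReal.mul_inv (by simp) (by simp), ← mul_assoc,
          ENNReal.mul_inv_cancel (by simp) (by simp), one_mul]
      _ ≤ _ := le_rfl
  obtain ⟨C₁, hC₁⟩ := exists_scaleEnergy_le K n hrn
  obtain ⟨C₂, hC₂⟩ := exists_scaleEnergy_zero_le hs (n := n) (by linarith)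
  set D : ℝ≥0 := (2 ^ n * ((2 ^ n * (n + 1) + n.factorial * K ^ n) * C₀)) ^ 2 * 2 ^ (n + 1) *
        K ^ (2 * n)
  refine ⟨D * ((n + 1 : ℕ) * (C₁ * (1 + C₂))), fun A M hA hMc hM1 hK g hg => ?_⟩
  have hM ξ : 0 < M ξ := zero_lt_one.trans_le (hM1 ξ)
  set Y := ∫⁻ ξ, ENNReal.ofReal (M ξ ^ (2 * s)) * ‖g ξ‖ₑ ^ 2
  calc scaleEnergy r M n n (fun ξ => A ξ * g ξ)
      ≤ ∑' m : ℕ, D * ∑ k ∈ Finset.range (n + 1), r ^ m * diffEnergy M n k ((1 / 2) ^ m) g := by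
        refine ENNReal.tsum_le_tsum fun m => ?_
        rw [← Finset.mul_sum, mul_left_comm]
        gcongr
        exact hA.diffEnergy_mul_le hMc hM hK (by positivity)
          (pow_le_one₀ (by norm_num) (by norm_num)) hg
    _ = D * ∑ k ∈ Finset.range (n + 1), scaleEnergy r M n k g := by
        rw [ENNReal.tsum_mul_left, Summable.tsum_finsetSum fun _ _ => ENNReal.summable]
        rfl
    _ ≤ D * ∑ k ∈ Finset.range (n + 1), C₁ * (scaleEnergy r M n n g + C₂ * Y) := by
        gcongr with k hk
        refine (hC₁ M hMc hM1 hK g hg k (by have := Finset.mem_range.1 hk; omega)).trans ?_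
        gcongr
        exact hC₂ M hMc (fun ξ => (hM ξ).le) g hg
    _ ≤ D * ∑ k ∈ Finset.range (n + 1), C₁ * ((1 + C₂) * (scaleEnergy r M n n g + Y)) := by
        gcongr
        rw [mul_add]
        gcongr
        · exact le_mul_of_one_le_left zero_le le_self_add
        · exact le_add_self
    _ = _ := by
        rw [Finset.sum_const, Finset.card_range, nsmul_eq_mul]
        push_cast
        ring

/-! ### The Airy symbol -/

/-- The entire extension of the symbol of `U(t)`. -/
noncomputable def airySymbol (t : ℝ) (z : ℂ) : ℂ :=
  Complex.exp (Complex.I * t * (2 * Real.pi * z) ^ 3)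

/-- The size of the derivative of the Airy phase. -/
noncomputable def airyWeight (t ξ : ℝ) : ℝ := (1 + |t|) * (1 + (2 * Real.pi * ξ) ^ 2)

theorem continuous_airyWeight (t : ℝ) : Continuous (airyWeight t) := by
  unfold airyWeight
  fun_prop

theorem one_le_airyWeight (t ξ : ℝ) : 1 ≤ airyWeight t ξ :=
  one_le_mul_of_one_le_of_one_le (by linarith [abs_nonneg t])
    (by linarith [sq_nonneg (2 * Real.pi * ξ)])

theorem exists_slowlyVarying_airyWeight (n : ℕ) :
    ∃ K : ℝ≥0, ∀ t, SlowlyVarying (airyWeight t) K n := by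
  -- From a² ≤ 2(a+b)² + 2b² with |b| ≤ 2πn; the factor 1 + |t| cancels, so K is independent of t.
  refine ⟨(2 * (1 + (2 * Real.pi * n) ^ 2)).toNNReal, fun t => ⟨?_, fun ξ d hd => ?_⟩⟩
  · rw [Real.one_le_toNNReal]
    nlinarith [sq_nonneg (2 * Real.pi * n)]
  · rw [Real.coe_toNNReal _ (by positivity), airyWeight, airyWeight, mul_left_comm]
    have hd2 : (2 * Real.pi * d) ^ 2 ≤ (2 * Real.pi * n) ^ 2 := by
      rw [mul_pow, mul_pow _ (n : ℝ)]
      have := sq_le_sq' (abs_le.1 hd).1 (abs_le.1 hd).2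
      gcongr
    refine mul_le_mul_of_nonneg_left ?_ (by positivity)
    have h1 : (2 * Real.pi * ξ) ^ 2 ≤
        2 * (2 * Real.pi * (ξ + d)) ^ 2 + 2 * (2 * Real.pi * d) ^ 2 := by
      nlinarith [sq_nonneg (2 * Real.pi * (ξ + d) + 2 * Real.pi * d)]
    nlinarith [mul_nonneg (sq_nonneg (2 * Real.pi * n)) (sq_nonneg (2 * Real.pi * (ξ + d)))]

theorem norm_airySymbol_ofReal (t ξ : ℝ) : ‖airySymbol t ξ‖ = 1 := by
  have : Complex.I * t * (2 * Real.pi * ξ) ^ 3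
      = ((t * (2 * Real.pi * ξ) ^ 3 : ℝ) : ℂ) * Complex.I := by push_cast; ring
  rw [airySymbol, this, Complex.norm_exp_ofReal_mul_I]

/-- With k = 2πξ and w = 2π(z - ξ), the phase changes by t·w(3k² + 3kw + w²). On the disc |w| ≤ 2π/M
this is bounded uniformly in t and ξ, and the real phase contributes modulus 1. -/
theorem exists_entireMultiplier_airySymbol :
    ∃ C : ℝ≥0, ∀ t, EntireMultiplier (airySymbol t) (airyWeight t) C := by
  -- c(1 + k²) dominates 3k² + 6π|k| + 4π², the bound for the quadratic factor when |w| ≤ 2π.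
  set c : ℝ := 3 + 6 * Real.pi + 4 * Real.pi ^ 2 with hc
  have hpi := Real.pi_pos
  refine ⟨(Real.exp (2 * Real.pi * c)).toNNReal, fun t => ⟨?_, fun ξ z hz => ?_⟩⟩
  · unfold airySymbol
    fun_prop
  rw [Real.coe_toNNReal _ (Real.exp_pos _).le]
  set k : ℝ := 2 * Real.pi * ξ with hk
  set w : ℂ := 2 * Real.pi * (z - ξ) with hw
  have hwn : ‖w‖ = 2 * Real.pi * ‖z - ξ‖ := by
    rw [hw, norm_mul, norm_mul, Complex.norm_real, Complex.norm_ofNat, Real.norm_of_nonneg hpi.le]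
  have hwM : ‖w‖ * ((1 + |t|) * (1 + k ^ 2)) ≤ 2 * Real.pi := by
    rw [hwn, mul_assoc]
    exact mul_le_of_le_one_right (by positivity) hz
  have hw1 : ‖w‖ ≤ 2 * Real.pi :=
    (le_mul_of_one_le_right (norm_nonneg w) (one_le_airyWeight t ξ)).trans hwM
  have htw : |t| * ‖w‖ * (1 + k ^ 2) ≤ 2 * Real.pi := by
    refine le_trans ?_ hwM
    nlinarith [mul_nonneg (norm_nonneg w) (by positivity : 0 ≤ 1 + k ^ 2)]
  have hfac : airySymbol t z = airySymbol t ξ *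
      Complex.exp (Complex.I * t * (w * (3 * k ^ 2 + 3 * k * w + w ^ 2))) := by
    rw [airySymbol, airySymbol, ← Complex.exp_add]
    congr 1
    rw [hk, hw]
    push_cast
    ring
  rw [hfac, norm_mul, norm_airySymbol_ofReal, one_mul, Complex.norm_exp]
  refine Real.exp_le_exp.2 ((Complex.re_le_norm _).trans ?_)
  have hq : ‖(3 * k ^ 2 + 3 * k * w + w ^ 2 : ℂ)‖ ≤ c * (1 + k ^ 2) := by
    calc ‖(3 * k ^ 2 + 3 * k * w + w ^ 2 : ℂ)‖ ≤ 3 * |k| ^ 2 + 3 * |k| * ‖w‖ + ‖w‖ ^ 2 := by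
          refine (norm_add₃_le).trans_eq ?_
          simp
      _ ≤ 3 * |k| ^ 2 + 3 * |k| * (2 * Real.pi) + (2 * Real.pi) ^ 2 := by gcongr
      _ ≤ _ := by
        rw [sq_abs, hc]
        have : |k| ≤ 1 + k ^ 2 := by nlinarith [sq_abs k, sq_nonneg (|k| - 1), abs_nonneg k]
        nlinarith [mul_le_mul_of_nonneg_left this hpi.le, mul_nonneg (sq_nonneg k) (sq_nonneg Real.pi)]
  rw [norm_mul, norm_mul, norm_mul, Complex.norm_I, one_mul, Complex.norm_real, Real.norm_eq_abs]
  calc |t| * (‖w‖ * ‖(3 * k ^ 2 + 3 * k * w + w ^ 2 : ℂ)‖)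
      ≤ |t| * (‖w‖ * (c * (1 + k ^ 2))) := by gcongr
    _ = (|t| * ‖w‖ * (1 + k ^ 2)) * c := by ring
    _ ≤ _ := by gcongr

theorem hasTemperateGrowth_airySymbol (t : ℝ) :
    Function.HasTemperateGrowth fun ξ : ℝ => airySymbol t ξ := by
  obtain ⟨C, hC⟩ := exists_entireMultiplier_airySymbol
  refine (hC t).hasTemperateGrowth (fun ξ => zero_lt_one.trans_le (one_le_airyWeight t ξ))
    (D := (1 + |t|) * (1 + (2 * Real.pi) ^ 2)) (p := 2) fun ξ => ?_
  rw [airyWeight, mul_assoc (1 + |t|), Real.norm_eq_abs]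
  refine mul_le_mul_of_nonneg_left ?_ (add_nonneg zero_le_one (abs_nonneg t))
  rw [mul_pow, ← sq_abs ξ]
  nlinarith [abs_nonneg ξ, sq_nonneg (2 * Real.pi), mul_nonneg (sq_nonneg (2 * Real.pi)) (abs_nonneg ξ)]

/-! ### Plancherel for iterated differences -/

/-- The character is entire and bounded on the strip |Im z| ≤ 1, so the Cauchy estimates apply with
M = 1. -/
theorem hasTemperateGrowth_exp_mul_sub_one (h : ℝ) : Function.HasTemperateGrowth
    fun x : ℝ => Complex.exp ((-2 * Real.pi * (h * x) : ℝ) * Complex.I) - 1 := by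
  have hE : EntireMultiplier (fun z => Complex.exp (-2 * Real.pi * (h * z) * Complex.I))
      (fun _ => 1) (Real.exp (2 * Real.pi * |h|)).toNNReal := by
    refine ⟨by fun_prop, fun ξ z hz => ?_⟩
    rw [Real.coe_toNNReal _ (Real.exp_pos _).le, Complex.norm_exp]
    refine Real.exp_le_exp.2 ?_
    have him : (-2 * Real.pi * (h * z) * Complex.I : ℂ).re = 2 * Real.pi * (h * (z - ξ).im) := by
      simp
    rw [him]
    have h1 : |(z - ξ).im| ≤ 1 := (Complex.abs_im_le_norm _).trans (by simpa using hz)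
    refine mul_le_mul_of_nonneg_left ((le_abs_self _).trans ?_) (by positivity)
    rw [abs_mul]
    exact mul_le_of_le_one_right (abs_nonneg h) h1
  have h1 := hE.hasTemperateGrowth (D := 1) (p := 0) (fun _ => one_pos) (by simp)
  convert h1.sub (.const 1) using 2 with x
  push_cast
  rfl

theorem SchwartzMap.lintegral_enorm_sq_fourier (f : SchwartzMap ℝ ℂ) :
    ∫⁻ ξ, ‖𝓕 (f : ℝ → ℂ) ξ‖ₑ ^ 2 = ∫⁻ x, ‖f x‖ₑ ^ 2 := by
  have key (g : SchwartzMap ℝ ℂ) : ∫⁻ x, ‖g x‖ₑ ^ 2 = ENNReal.ofReal (∫ x, ‖g x‖ ^ 2) := by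
    have hint : Integrable fun x => ‖g x‖ ^ 2 := (g.memLp 2).integrable_norm_pow two_ne_zero
    rw [ofReal_integral_eq_lintegral_ofReal hint (.of_forall fun x => by positivity)]
    simp [ENNReal.ofReal_pow, ofReal_norm]
  rw [key, ← f.integral_norm_sq_fourier, ← key]
  rfl

/-- Differencing the transform multiplies f by exp(-2πihx) - 1, which keeps it Schwartz, so the step
can be iterated down to Plancherel. -/
theorem SchwartzMap.lintegral_enorm_sq_fwdDiff_iter_fourier (h : ℝ) (n : ℕ)
    (f : SchwartzMap ℝ ℂ) : ∫⁻ ξ, ‖(fwdDiff h)^[n] (𝓕 (f : ℝ → ℂ)) ξ‖ₑ ^ 2 =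
      ∫⁻ x, ‖Complex.exp ((-2 * Real.pi * (h * x) : ℝ) * Complex.I) - 1‖ₑ ^ (2 * n) *
        ‖f x‖ₑ ^ 2 := by
  induction n generalizing f with
  | zero => simpa using f.lintegral_enorm_sq_fourier
  | succ n ih =>
    have hχ := hasTemperateGrowth_exp_mul_sub_one h
    set χ : ℝ → ℂ := fun x : ℝ => Complex.exp ((-2 * Real.pi * (h * x) : ℝ) * Complex.I) - 1 with hχd
    set F : SchwartzMap ℝ ℂ := SchwartzMap.smulLeftCLM ℂ χ f with hF
    have hFx (x : ℝ) : F x = χ x * f x := by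
      rw [hF, SchwartzMap.smulLeftCLM_apply_apply hχ, smul_eq_mul]
    have hint (ξ : ℝ) : Integrable fun x : ℝ =>
        Complex.exp ((-2 * Real.pi * x * ξ : ℝ) * Complex.I) • f x := by
      refine f.integrable.norm.mono' ?_ (.of_forall fun x => ?_)
      · exact (by fun_prop : Continuous _).aestronglyMeasurable
      · rw [norm_smul, Complex.norm_exp_ofReal_mul_I, one_mul]
    have hdiff : fwdDiff h (𝓕 (f : ℝ → ℂ)) = 𝓕 (F : ℝ → ℂ) := by
      ext ξ
      rw [fwdDiff, Real.fourier_real_eq_integral_exp_smul, Real.fourier_real_eq_integral_exp_smul,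
        Real.fourier_real_eq_integral_exp_smul, ← integral_sub (hint _) (hint _)]
      refine integral_congr_ae (.of_forall fun x => ?_)
      simp only [smul_eq_mul, hFx, hχd]
      have : Complex.exp ((-2 * Real.pi * x * (ξ + h) : ℝ) * Complex.I) =
          Complex.exp ((-2 * Real.pi * x * ξ : ℝ) * Complex.I) *
          Complex.exp ((-2 * Real.pi * (h * x) : ℝ) * Complex.I) := by
        rw [← Complex.exp_add]
        congr 1
        push_cast
        ring
      rw [this]
      ring
    rw [Function.iterate_succ_apply, hdiff, ih F]
    refine lintegral_congr fun x => ?_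
    rw [hFx, enorm_mul]
    ring

theorem SchwartzMap.scaleEnergy_fourier (r : ℝ≥0) (M : ℝ → ℝ) (n : ℕ) (f : SchwartzMap ℝ ℂ) :
    scaleEnergy r M n n (𝓕 (f : ℝ → ℂ)) = ∫⁻ x, (∑' m : ℕ, (r : ℝ≥0∞) ^ m *
      ‖Complex.exp ((-2 * Real.pi * ((1 / 2) ^ m * x) : ℝ) * Complex.I) - 1‖ₑ ^ (2 * n)) *
        ‖f x‖ₑ ^ 2 := by
  simp only [← ENNReal.tsum_mul_right, mul_assoc ((r : ℝ≥0∞) ^ _)]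
  have hf : Measurable f := f.continuous.measurable
  rw [lintegral_tsum fun m => by fun_prop]
  refine tsum_congr fun m => ?_
  rw [lintegral_const_mul' _ _ (by finiteness), ← f.lintegral_enorm_sq_fwdDiff_iter_fourier]
  simp [diffEnergy]

/-- One half of the norm equivalence, used for the solution; `exists_scaleEnergy_fourier_le` is the
other half, used for the data. -/
theorem SchwartzMap.lintegral_rpow_le_scaleEnergy {s : ℝ} (hs : 0 < s) (n : ℕ) (M : ℝ → ℝ)
    (f : SchwartzMap ℝ ℂ) : ∫⁻ x, ENNReal.ofReal (|x| ^ (2 * s)) * ‖f x‖ₑ ^ 2 ≤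
      (∫⁻ ξ, ‖𝓕 (f : ℝ → ℂ) ξ‖ₑ ^ 2) +
        scaleEnergy (ENNReal.ofReal (4 ^ s)) M n n (𝓕 (f : ℝ → ℂ)) := by
  have hf : Measurable f := f.continuous.measurable
  rw [ENNReal.ofReal, SchwartzMap.scaleEnergy_fourier, lintegral_enorm_sq_fourier,
    ← lintegral_add_left (by fun_prop)]
  refine lintegral_mono fun x => ?_
  rw [← one_add_mul]
  gcongr
  exact rpow_le_one_add_tsum hs n x

theorem exists_scaleEnergy_fourier_le {s : ℝ} (hs : 0 < s) {n : ℕ} (hn : s < n) :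
    ∃ C : ℝ≥0, ∀ (M : ℝ → ℝ) (f : SchwartzMap ℝ ℂ),
      scaleEnergy (ENNReal.ofReal (4 ^ s)) M n n (𝓕 (f : ℝ → ℂ)) ≤
        C * ∫⁻ x, ENNReal.ofReal (|x| ^ (2 * s)) * ‖f x‖ₑ ^ 2 := by
  obtain ⟨C, hC⟩ := exists_tsum_enorm_exp_sub_one_le hs hn
  refine ⟨C, fun M f => ?_⟩
  rw [ENNReal.ofReal, SchwartzMap.scaleEnergy_fourier, ← lintegral_const_mul' _ _ (by finiteness)]
  refine lintegral_mono fun x => ?_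
  rw [← mul_assoc]
  gcongr
  exact hC x

theorem eLpNorm_smul_two_sq {φ : ℝ → ℝ} (hφ : ∀ x, 0 ≤ φ x) (f : ℝ → ℂ) :
    eLpNorm (fun x => φ x • f x) 2 volume ^ 2 = ∫⁻ x, ENNReal.ofReal (φ x ^ 2) * ‖f x‖ₑ ^ 2 := by
  rw [eLpNorm_eq_lintegral_rpow_enorm_toReal two_ne_zero ENNReal.ofNat_ne_top]
  simp only [ENNReal.toReal_ofNat, ENNReal.rpow_ofNat]
  rw [← ENNReal.rpow_natCast, ← ENNReal.rpow_mul]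
  rw [Nat.cast_ofNat, one_div_mul_cancel two_ne_zero, ENNReal.rpow_one]
  refine lintegral_congr fun x => ?_
  rw [enorm_smul, mul_pow, ENNReal.ofReal_pow (hφ x), Real.enorm_of_nonneg (hφ x)]

theorem weightedNorm_sq (s : ℝ) (f : ℝ → ℂ) :
    weightedNorm s f ^ 2 = ∫⁻ x, ENNReal.ofReal (|x| ^ (2 * s)) * ‖f x‖ₑ ^ 2 := by
  rw [weightedNorm, eLpNorm_smul_two_sq fun x => by positivity]
  simp only [← Real.rpow_mul_natCast (abs_nonneg _), Nat.cast_ofNat, mul_comm s]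

/-- The source of the 2s derivatives: M is quadratic in the frequency, so M^s costs twice s. -/
theorem lintegral_airyWeight_rpow (s t : ℝ) (f : ℝ → ℂ) :
    ∫⁻ ξ, ENNReal.ofReal (airyWeight t ξ ^ (2 * s)) * ‖𝓕 f ξ‖ₑ ^ 2 =
      (ENNReal.ofReal ((1 + |t|) ^ s) * sobolevNorm (2 * s) f) ^ 2 := by
  rw [mul_pow, sobolevNorm, eLpNorm_smul_two_sq fun ξ => by positivity,
    ← lintegral_const_mul' _ _ (by finiteness)]
  refine lintegral_congr fun ξ => ?_
  rw [← mul_assoc, ← ENNReal.ofReal_pow (by positivity), ← ENNReal.ofReal_mul (by positivity),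
    airyWeight, Real.mul_rpow (by positivity) (by positivity)]
  congr 3
  · rw [← Real.rpow_mul_natCast (by positivity), Nat.cast_ofNat, mul_comm s]
  · rw [← Real.rpow_mul_natCast (by positivity)]
    congr 1
    push_cast
    ring

/-! ### The theorem -/

/-- The symbol has temperate growth, so the solution is Schwartz and the Plancherel identities apply
to it. -/
theorem exists_schwartzMap_airyGroup {f : ℝ → ℂ} (hf : ContDiff ℝ ∞ f) (hc : HasCompactSupport f)
    (t : ℝ) : ∃ u : SchwartzMap ℝ ℂ, airyGroup t f = u ∧
      𝓕 (u : ℝ → ℂ) = fun ξ : ℝ => airySymbol t ξ * 𝓕 f ξ := by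
  let g : SchwartzMap ℝ ℂ := hc.toSchwartzMap hf
  have hg : 𝓕 f = (𝓕 g : SchwartzMap ℝ ℂ) := SchwartzMap.fourier_coe g
  set G : SchwartzMap ℝ ℂ :=
    SchwartzMap.smulLeftCLM ℂ (fun ξ : ℝ => airySymbol t ξ) (𝓕 g) with hG
  have hGx : (G : ℝ → ℂ) = fun ξ : ℝ => airySymbol t ξ * 𝓕 f ξ := by
    ext ξ
    rw [hG, SchwartzMap.smulLeftCLM_apply_apply (hasTemperateGrowth_airySymbol t), smul_eq_mul, hg]
  refine ⟨𝓕⁻ G, ?_, ?_⟩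
  · rw [SchwartzMap.fourierInv_coe, hGx]
    rfl
  · rw [← hGx, ← SchwartzMap.fourier_coe, FourierTransform.fourier_fourierInv_eq]

theorem lemma4p6 (s : ℝ) (hs : 0 ≤ s) :
    ∃ C : ℝ≥0, ∀ u₀ : ℝ → ℂ, ContDiff ℝ ∞ u₀ → HasCompactSupport u₀ → ∀ t : ℝ,
      weightedNorm s (airyGroup t u₀) ≤
        (C : ℝ≥0∞) * (ENNReal.ofReal (1 + |t| + |t| ^ s) * sobolevNorm (2 * s) u₀ +
          weightedNorm s u₀) := by
  -- Bounds the L² part left over by the dyadic comparison: |A| = 1 on the line and M ≥ 1.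
  have hsymb (t : ℝ) (u₀ : ℝ → ℂ) : ∫⁻ ξ : ℝ, ‖airySymbol t ξ * 𝓕 u₀ ξ‖ₑ ^ 2 ≤
      (ENNReal.ofReal ((1 + |t|) ^ s) * sobolevNorm (2 * s) u₀) ^ 2 := by
    rw [← lintegral_airyWeight_rpow]
    refine lintegral_mono fun ξ => ?_
    rw [enorm_mul, ← ofReal_norm, norm_airySymbol_ofReal, ENNReal.ofReal_one, one_mul]
    refine le_mul_of_one_le_left zero_le ?_
    rw [← ENNReal.ofReal_one]
    exact ENNReal.ofReal_le_ofReal (Real.one_le_rpow (one_le_airyWeight t ξ) (by positivity))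
  have hsq : ∃ C : ℝ≥0, ∀ u₀ : ℝ → ℂ, ContDiff ℝ ∞ u₀ → HasCompactSupport u₀ → ∀ t : ℝ,
      weightedNorm s (airyGroup t u₀) ^ 2 ≤
        (C : ℝ≥0∞) * ((ENNReal.ofReal ((1 + |t|) ^ s) * sobolevNorm (2 * s) u₀) ^ 2 +
          weightedNorm s u₀ ^ 2) := by
    -- The dyadic comparison needs s > 0; for s = 0 Plancherel alone suffices.
    rcases hs.eq_or_lt with rfl | hs
    · refine ⟨1, fun u₀ hu hc t => ?_⟩
      obtain ⟨u, hu1, hu2⟩ := exists_schwartzMap_airyGroup hu hc t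
      rw [ENNReal.coe_one, one_mul, hu1]
      refine le_trans ?_ (le_self_add.trans' (hsymb t u₀))
      have h1 : ∫⁻ ξ : ℝ, ‖airySymbol t ξ * 𝓕 u₀ ξ‖ₑ ^ 2 = ∫⁻ ξ, ‖𝓕 (u : ℝ → ℂ) ξ‖ₑ ^ 2 := by
        rw [hu2]
      rw [weightedNorm_sq, h1, u.lintegral_enorm_sq_fourier]
      simp
    · obtain ⟨n, hn⟩ := exists_nat_ge (s + 1)
      obtain ⟨K, hK⟩ := exists_slowlyVarying_airyWeight n
      obtain ⟨C₀, hC₀⟩ := exists_entireMultiplier_airySymbol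
      obtain ⟨C₁, hC₁⟩ := exists_scaleEnergy_mul_le hs hn K C₀
      obtain ⟨C₂, hC₂⟩ := exists_scaleEnergy_fourier_le hs (n := n) (by linarith)
      refine ⟨1 + C₁ * (1 + C₂), fun u₀ hu hc t => ?_⟩
      obtain ⟨u, hu1, hu2⟩ := exists_schwartzMap_airyGroup hu hc t
      let g : SchwartzMap ℝ ℂ := hc.toSchwartzMap hu
      have hg : 𝓕 u₀ = (𝓕 g : SchwartzMap ℝ ℂ) := SchwartzMap.fourier_coe g
      have hcont : Continuous (𝓕 u₀) := hg ▸ (𝓕 g : SchwartzMap ℝ ℂ).continuous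
      have h1 := u.lintegral_rpow_le_scaleEnergy hs n (airyWeight t)
      have h2 := hC₁ _ _ (hC₀ t) (continuous_airyWeight t) (one_le_airyWeight t) (hK t) _ hcont
      have h3 := hC₂ (airyWeight t) g
      have h4 : (g : ℝ → ℂ) = u₀ := rfl
      rw [h4, ← weightedNorm_sq] at h3
      rw [lintegral_airyWeight_rpow] at h2
      rw [hu2, ← weightedNorm_sq, ← hu1] at h1
      set Y := (ENNReal.ofReal ((1 + |t|) ^ s) * sobolevNorm (2 * s) u₀) ^ 2
      set W := weightedNorm s u₀ ^ 2
      calc _ ≤ _ := h1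
        _ ≤ (Y + W) + C₁ * (C₂ * W + Y) := by
          refine add_le_add ((hsymb t u₀).trans le_self_add) (h2.trans ?_)
          gcongr
        _ ≤ (Y + W) + C₁ * ((1 + C₂) * (Y + W)) := by
          refine add_le_add le_rfl (mul_le_mul_right ?_ _)
          rw [add_comm, add_mul, one_mul]
          gcongr
          · exact le_self_add
          · exact le_add_self
        _ = _ := by
          push_cast
          ring
  obtain ⟨C, hC⟩ := hsq
  have hT (t : ℝ) : (1 + |t|) ^ s ≤ 2 ^ s * (1 + |t| + |t| ^ s) := by
    rcases le_total |t| 1 with ht | ht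
    · calc (1 + |t|) ^ s ≤ 2 ^ s := Real.rpow_le_rpow (by positivity) (by linarith) hs
        _ ≤ _ := le_mul_of_one_le_right (by positivity) (by
          linarith [abs_nonneg t, Real.rpow_nonneg (abs_nonneg t) s])
    · calc (1 + |t|) ^ s ≤ (2 * |t|) ^ s := Real.rpow_le_rpow (by positivity) (by linarith) hs
        _ = 2 ^ s * |t| ^ s := Real.mul_rpow (by norm_num) (abs_nonneg t)
        _ ≤ _ := by
          gcongr
          linarith [abs_nonneg t]
  have h2s : (1 : ℝ≥0) ≤ 2 ^ s := NNReal.one_le_rpow one_le_two hs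
  refine ⟨NNReal.sqrt C * 2 ^ s, fun u₀ hu hc t => ?_⟩
  set N := sobolevNorm (2 * s) u₀
  set W := weightedNorm s u₀
  have h1 : weightedNorm s (airyGroup t u₀) ≤
      -- Square root of `hC`, using a² + b² ≤ (a + b)².
      NNReal.sqrt C * (ENNReal.ofReal ((1 + |t|) ^ s) * N + W) := by
    refine (ENNReal.pow_le_pow_left_iff two_ne_zero).1 ((hC u₀ hu hc t).trans ?_)
    rw [mul_pow (NNReal.sqrt C : ℝ≥0∞), ← ENNReal.coe_pow, NNReal.sq_sqrt, add_sq]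
    gcongr
    exact le_self_add
  refine h1.trans ?_
  rw [ENNReal.coe_mul, mul_assoc]
  gcongr
  rw [mul_add, ← mul_assoc]
  gcongr
  · rw [← ENNReal.ofReal_coe_nnreal, ← ENNReal.ofReal_mul (NNReal.coe_nonneg _)]
    exact ENNReal.ofReal_le_ofReal (by simpa using hT t)
  · exact le_mul_of_one_le_left zero_le (by exact_mod_cast h2s)
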